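/- **Setting.** Let $f(t,x,u)$ be a polynomial vector field on $\mathbb R\times\mathbb R^n\times\mathbb R^m$ with values in $\mathbb R^n$, $T>0$, $X=\prod_{p}[\mathrm{lo}_p,\mathrm{hi}_p]\subset\mathbb R^n$ a box with $\mathrm{lo}_p<\mathrm{hi}_p$, and $U=\{u: g^U_j(u)\ge 0\ \forall j\}$, $X_T=\{x: g^{X_T}_j(x)\ge 0\ \forall j\}$ basic semialgebraic sets. The time axis is split at points $0=T_1\le T_2\le\dots\le T_K=T$, and each state axis $p$ is split at finitely many points in $[\mathrm{lo}_p,\mathrm{hi}_p]$, in nondecreasing order. The vector $\theta$ collects all interior split positions of the time axis and of the state axes; their numbers are fixed. The set of all ordered $\theta$ (coincidences allowed) is denoted by $\Theta$. The splits divide $X$ into boxes $X_i=X_i(\theta)$, one for each choice of one interval on each axis. $(a,b)\in N_X$ means that $X_a,X_b$ are consecutive along one axis $p$, in this order, and equal in all other axes; then $h_{a,b}=e_p$ is the normal vector of the common facet $X_a\cap X_b$, which lies in $\{x_p=\rho\}$ for a split position $\rho$. Put $\mathcal L v=\partial_t v+\nabla_x v\cdot f$. **Relaxation.** The sum-of-squares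 relaxation for $\theta$ is $$\inf\ \sum_i \mathbf w_i^\top l_i$$ over polynomials $v_{i,k}(t,x)$ and $w_i(x)$, where $\mathbf w_i$ is the coefficient vector of $w_i$ and $l_i$ the vector of the Lebesgue moments of $X_i$, such that for all $i$, all $k\in\{1,\dots,K-1\}$ and all $(a,b)\in N_X$ the following polynomials have a representation $q+\sum_j s_j g_j$ in which $q$ and all $s_j$ are sums of squares and the $g_j$ are as listed: 1. $-\mathcal L v_{i,k}$, with the $g_j$ describing $[T_k,T_{k+1}]\times X_i\times U$; 2. $w_i-v_{i,1}(0,\cdot)-1$, with the $g_j$ describing $X_i$; 3. $v_{i,K-1}(T,\cdot)$, with the $g_j$ describing $X_T\cap X_i$; 4. $w_i$, with the $g_j$ describing $X_i$; 5. $v_{i,k}(T_{k+1},\cdot)-v_{i,k+1}(T_{k+1},\cdot)$ for $k\le K-2$, with the $g_j$ describing $X_i$; 6. $v_{a,k}-v_{b,k}$ at $x_p=\rho$, with the $g_j$ describing $[T_k,T_{k+1}]\times(X_a\cap X_b)\times U$, together with $h_{a,b}^\top f$ at $x_p=\rho$; 7. $v_{b,k}-v_{a,k}$ at $x_p=\rho$,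 with the $g_j$ describing $[T_k,T_{k+1}]\times(X_a\cap X_b)\times U$, together with $-h_{a,b}^\top f$ at $x_p=\rho$. (6 and 7 are identities in $t$, $u$ and the state coordinates other than $x_p$.) Intervals $[\alpha,\beta]$ of time and of state coordinates are described by $(z-\alpha)(\beta-z)$, the sets $U$ and $X_T$ by the $g^U_j$ and $g^{X_T}_j$, and to the description of each set a ball constraint $\rho_{\mathrm B}^2-\|z\|^2$ of fixed radius in all its variables may be added. The degrees of $v_{i,k}$, $w_i$ and of the squared polynomials are fixed independently of $\theta$, in such a way that the degrees of all polynomials in the relaxation ($v_{i,k}$, $w_i$, $\mathcal Lv_{i,k}$ and all products $s_jg_j$, $q$) do not exceed a given order $d$. Let $p^\star(\theta)$ be the infimum of this problem. **SDP form.** Taking the coefficients of the $v_{i,k}$, $w_i$ and the Gram matrices (in monomial bases) of all sums of squares as the vector $x$ of decision variables, and comparing coefficients (for all monomials that can occur), the relaxation becomes the first program of the primal-dual pair $$\min\ c^\top x\ \text{ s.t. } Ax+s=b,\ s\in\mathcal K,\qquad\qquad \min\ b^\top y\ \text{ s.t. } A^\top y+c=0,\ y\in\mathcal K^\star,$$ with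 data $A,b,c$ depending on $\theta$, where $\mathcal K$ is the product of a zero cone (coefficient equations) and cones of positive semidefinite matrices (the slack blocks of $s$ being the Gram matrices), and $\mathcal K^\star$ is its dual cone. A primal-dual solution is a triple $(x,s,y)$ such that $(x,s)$ is optimal for the first and $y$ for the second program. It is strictly complementary if in each semidefinite block, of size $r$, the matrices $S$ and $Y$ given by $s$ and $y$ satisfy $\operatorname{rank}S+\operatorname{rank}Y=r$. **Statement.** Let $\theta\in\Theta$ and suppose that * (Assumption 1) for each of the sets in 1–7 above (without the sign condition on $\pm h_{a,b}^\top f$), the description contains a ball constraint $\rho_{\mathrm B}^2-\|z\|^2\ge0$ that holds on the set, or the set is described as a box, with a constraint of the form $\rho^2-(z_j-c_j)^2\ge0$ for each of its coordinates $z_j$; * (Assumption 2) for all $(a,b)\in N_X$, $h_{a,b}^\top f(t,x,u)\ne0$ for all $t\in[0,T]$, $x\in X_a\cap X_b$, $u\in U$; * for the data at $\theta$, the primal-dual solution of the SDP form exists, is unique, and is strictly complementary. Then for all $\theta'\in\Theta$ close to $\theta$ the infimum $p^\star(\theta')$ is finite (the problem is feasible and bounded below), and $p^\star$ is differentiable at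 $\theta$ relative to $\Theta$. In particular, if the split positions in $\theta$ are strictly ordered (so that $\theta$ is an interior point of $\Theta$), then $p^\star$ is differentiable at $\theta$. -/

import Mathlib

open Filter Topology MeasureTheory

noncomputable section

/-! ## Conic programs over a product of a zero cone and cones of semidefinite matrices -/

/-- The symmetric matrix encoded by a vector: diagonal entries are stored as they are, off-diagonal
entries are stored multiplied by `√2`, so that the dot product of two vectors is the trace inner
product of the two matrices. -/
def smat {σ : Type} [DecidableEq σ] (v : Sym2 σ → ℝ) : Matrix σ σ ℝ :=
  Matrix.of fun i j => if i = j then v s(i, j) else v s(i, j) / Real.sqrt 2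

/-- Data `(A, b, c)` of the primal-dual pair
`min cᵀx  s.t.  A x + s = b, s ∈ K`  and  `min bᵀy  s.t.  Aᵀ y + c = 0, y ∈ K*`,
with decision variables indexed by `N`, equality rows indexed by `E`, and semidefinite blocks indexed
by `B`, the block `β` having rows and columns indexed by `σ β`. -/
structure ConicSDP (N E B : Type) (σ : B → Type) where
  A : Matrix (E ⊕ (Σ β : B, Sym2 (σ β))) N ℝ
  b : E ⊕ (Σ β : B, Sym2 (σ β)) → ℝ
  c : N → ℝ

namespace ConicSDP

variable {N E B : Type} {σ : B → Type} [Fintype N] [Fintype E] [Fintype B]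
  [∀ β, Fintype (σ β)] [∀ β, DecidableEq (σ β)]

/-- The semidefinite block `β` of a vector, as a symmetric matrix. -/
def block (s : E ⊕ (Σ β : B, Sym2 (σ β)) → ℝ) (β : B) : Matrix (σ β) (σ β) ℝ :=
  smat fun e => s (Sum.inr ⟨β, e⟩)

/-- The cone `K`: the zero cone on the equality rows, positive semidefinite matrices on the blocks. -/
def cone (E : Type) {B : Type} (σ : B → Type) [∀ β, DecidableEq (σ β)] :
    Set (E ⊕ (Σ β : B, Sym2 (σ β)) → ℝ) :=
  {s | (∀ e, s (Sum.inl e) = 0) ∧ ∀ β, (block s β).PosSemidef}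

/-- The dual cone `K*`. -/
def dualCone (E : Type) {B : Type} (σ : B → Type) [Fintype E] [Fintype B]
    [∀ β, Fintype (σ β)] [∀ β, DecidableEq (σ β)] :
    Set (E ⊕ (Σ β : B, Sym2 (σ β)) → ℝ) :=
  {y | ∀ s ∈ cone E σ, 0 ≤ s ⬝ᵥ y}

/-- `(x, s)` is feasible for the primal program. -/
def PrimalFeasible (D : ConicSDP N E B σ) (x : N → ℝ) (s : E ⊕ (Σ β : B, Sym2 (σ β)) → ℝ) : Prop :=
  D.A.mulVec x + s = D.b ∧ s ∈ cone E σ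

/-- `y` is feasible for the dual program. -/
def DualFeasible (D : ConicSDP N E B σ) (y : E ⊕ (Σ β : B, Sym2 (σ β)) → ℝ) : Prop :=
  D.A.transpose.mulVec y + D.c = 0 ∧ y ∈ dualCone E σ

/-- A primal-dual solution: `(x, s)` is optimal for the primal and `y` is optimal for the dual. -/
def IsSolution (D : ConicSDP N E B σ) (x : N → ℝ) (s y : E ⊕ (Σ β : B, Sym2 (σ β)) → ℝ) : Prop :=
  D.PrimalFeasible x s ∧ (∀ x' s', D.PrimalFeasible x' s' → D.c ⬝ᵥ x ≤ D.c ⬝ᵥ x') ∧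
  D.DualFeasible y ∧ (∀ y', D.DualFeasible y' → D.b ⬝ᵥ y ≤ D.b ⬝ᵥ y')

/-- Strict complementarity: in every semidefinite block the ranks of the primal slack matrix and of
the dual matrix sum up to the size of the block. -/
def StrictlyComplementary (s y : E ⊕ (Σ β : B, Sym2 (σ β)) → ℝ) : Prop :=
  ∀ β, (block s β).rank + (block y β).rank = Fintype.card (σ β)

/-- The primal-dual solution exists, is unique, and is strictly complementary. -/
def HasUniqueStrictSolution (D : ConicSDP N E B σ) : Prop :=
  ∃ x s y, D.IsSolution x s y ∧
    (∀ x' s' y', D.IsSolution x' s' y' → x' = x ∧ s' = s ∧ y' = y) ∧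
    StrictlyComplementary s y

end ConicSDP

/-! ## Polynomials of bounded degree in some of the variables, and sums of squares -/

/-- The variables `(t, x, u)`. -/
abbrev ZVar (n m : ℕ) : Type := Unit ⊕ Fin n ⊕ Fin m

/-- Polynomials in `(t, x, u)`. -/
abbrev ZPoly (n m : ℕ) : Type := MvPolynomial (ZVar n m) ℝ

/-- The time variable. -/
abbrev tv {n m : ℕ} : ZVar n m := Sum.inl ()

/-- The state variables. -/
abbrev xv {n m : ℕ} (p : Fin n) : ZVar n m := Sum.inr (Sum.inl p)

/-- The input variables. -/
abbrev uv {n m : ℕ} (j : Fin m) : ZVar n m := Sum.inr (Sum.inr j)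

/-- The set of all state variables. -/
def xVars (n m : ℕ) : Finset (ZVar n m) := Finset.univ.image xv

/-- The set of the time variable and all state variables. -/
def txVars (n m : ℕ) : Finset (ZVar n m) := insert tv (xVars n m)

/-- Polynomials in the variables `V` of degree at most `δ`. -/
def IsPolyIn {n m : ℕ} (V : Finset (ZVar n m)) (δ : ℕ) (p : ZPoly n m) : Prop :=
  p.vars ⊆ V ∧ p.totalDegree ≤ δ

/-- Sums of squares of polynomials in the variables `V` of degree at most `δ`. -/
def IsSOSIn {n m : ℕ} (V : Finset (ZVar n m)) (δ : ℕ) (q : ZPoly n m) : Prop :=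
  ∃ (N : ℕ) (p : Fin N → ZPoly n m), (∀ j, IsPolyIn V δ (p j)) ∧ q = ∑ j, p j ^ 2

/-- The monomials in the variables `V` of degree at most `δ`, as exponents. -/
def Mono {n m : ℕ} (V : Finset (ZVar n m)) (δ : ℕ) : Type :=
  {e : ZVar n m →₀ ℕ // e.support ⊆ V ∧ e.degree ≤ δ}

instance {n m : ℕ} (V : Finset (ZVar n m)) (δ : ℕ) : Finite (Mono V δ) :=
  ((Finsupp.finite_of_degree_le (σ := ZVar n m) δ).subset
    (fun _ h => h.2 : {e : ZVar n m →₀ ℕ | e.support ⊆ V ∧ e.degree ≤ δ} ⊆ _)).to_subtype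

instance {n m : ℕ} (V : Finset (ZVar n m)) (δ : ℕ) : Fintype (Mono V δ) := Fintype.ofFinite _

instance {n m : ℕ} (V : Finset (ZVar n m)) (δ : ℕ) : DecidableEq (Mono V δ) := Classical.decEq _

/-- The polynomial with Gram matrix `G` in the monomial basis. -/
def gramPoly {n m : ℕ} {V : Finset (ZVar n m)} {δ : ℕ} (G : Matrix (Mono V δ) (Mono V δ) ℝ) :
    ZPoly n m :=
  ∑ a, ∑ b, MvPolynomial.monomial (a.1 + b.1) (G a b)

/-- The substitution of the number `a` for the variable `z`. -/
def substVar {n m : ℕ} (z : ZVar n m) (a : ℝ) (p : ZPoly n m) : ZPoly n m :=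
  MvPolynomial.aeval (fun v => if v = z then MvPolynomial.C a else MvPolynomial.X v) p

/-- The polynomial `(z - a) (b - z)`, which describes the interval `[a, b]`. -/
def intervalPoly {n m : ℕ} (z : ZVar n m) (a b : ℝ) : ZPoly n m :=
  (MvPolynomial.X z - MvPolynomial.C a) * (MvPolynomial.C b - MvPolynomial.X z)

/-! ## The split region-of-attraction problem -/

/-- A region-of-attraction problem for `x' = f(t, x, u)` on `[0, T]`, with a box `X = ∏ [lo p, hi p]`
of states, basic semialgebraic sets `U` and `X_T` of inputs and of target states, and the number of
interior split positions: `nt` of the time axis, `r p` of the `p`-th state axis. -/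
structure SplitROA where
  n : ℕ
  m : ℕ
  f : Fin n → ZPoly n m
  T : ℝ
  T_pos : 0 < T
  lo : Fin n → ℝ
  hi : Fin n → ℝ
  lo_lt_hi : ∀ p, lo p < hi p
  nU : ℕ
  gU : Fin nU → MvPolynomial (Fin m) ℝ
  nXT : ℕ
  gXT : Fin nXT → MvPolynomial (Fin n) ℝ
  nt : ℕ
  r : Fin n → ℕ

namespace SplitROA

/-- The index type of the split positions. -/
abbrev Split (P : SplitROA) : Type := Fin P.nt ⊕ (Σ p : Fin P.n, Fin (P.r p))

/-- A cell of the state space: the choice of one interval on each axis. -/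
abbrev Cell (P : SplitROA) : Type := ∀ p : Fin P.n, Fin (P.r p + 1)

/-- A common facet of two neighbouring cells: an axis `p`, a split position of that axis (the number
`j`), and the cell `a` whose upper boundary in direction `p` is at this position.
The unit normal vector, pointing from the lower to the upper cell, is the basis vector `e_p`. -/
abbrev Facet (P : SplitROA) : Type :=
  {F : (Σ p : Fin P.n, Fin (P.r p)) × P.Cell // F.2 F.1.1 = F.1.2.castSucc}

variable (P : SplitROA)

/-- The boundary points of the time intervals: `0`, the time splits, `T`. -/
def timeNode (θ : P.Split → ℝ) : Fin (P.nt + 2) → ℝ :=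
  Fin.cons 0 (Fin.snoc (fun k => θ (Sum.inl k)) P.T : Fin (P.nt + 1) → ℝ)

/-- The boundary points of the intervals on the axis `p`: `lo p`, the splits, `hi p`. -/
def axisNode (θ : P.Split → ℝ) (p : Fin P.n) : Fin (P.r p + 2) → ℝ :=
  Fin.cons (P.lo p) (Fin.snoc (fun j => θ (Sum.inr ⟨p, j⟩)) (P.hi p) : Fin (P.r p + 1) → ℝ)

/-- The split positions which are in increasing order, possibly with coincidences. -/
def ordered : Set (P.Split → ℝ) :=
  {θ | Monotone (P.timeNode θ) ∧ ∀ p, Monotone (P.axisNode θ p)}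

/-- The split positions which are in strictly increasing order. -/
def strictlyOrdered : Set (P.Split → ℝ) :=
  {θ | StrictMono (P.timeNode θ) ∧ ∀ p, StrictMono (P.axisNode θ p)}

/-- The box `X_i`. -/
def cellSet (θ : P.Split → ℝ) (i : P.Cell) : Set (Fin P.n → ℝ) :=
  {x | ∀ p, P.axisNode θ p (i p).castSucc ≤ x p ∧ x p ≤ P.axisNode θ p (i p).succ}

/-- The Lebesgue moment of `X_i` for the exponents `e` of the state variables. -/
def moment (θ : P.Split → ℝ) (i : P.Cell) (e : ZVar P.n P.m →₀ ℕ) : ℝ :=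
  ∫ x in P.cellSet θ i, ∏ p, x p ^ e (xv p)

/-- The set `U`. -/
def inputSet : Set (Fin P.m → ℝ) := {u | ∀ j, 0 ≤ MvPolynomial.eval u (P.gU j)}

variable {P} in
/-- The lower cell `X_a` of a facet. -/
def Facet.lower (F : P.Facet) : P.Cell := F.1.2

variable {P} in
/-- The upper cell `X_b` of a facet. -/
def Facet.upper (F : P.Facet) : P.Cell := Function.update F.1.2 F.1.1.1 F.1.1.2.succ

variable {P} in
/-- The axis of the normal vector of a facet. -/
def Facet.axis (F : P.Facet) : Fin P.n := F.1.1.1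

variable {P} in
/-- The position of a facet on the axis of its normal vector. -/
def Facet.pos (F : P.Facet) (θ : P.Split → ℝ) : ℝ := θ (Sum.inr F.1.1)

/-- The component of the vector field along the normal vector is nonzero on the boundary between any
two neighbouring cells, for all times and all inputs. -/
def FlowNonzero (θ : P.Split → ℝ) : Prop :=
  ∀ F : P.Facet, ∀ t ∈ Set.Icc 0 P.T, ∀ x ∈ P.cellSet θ F.lower ∩ P.cellSet θ F.upper,
    ∀ u ∈ P.inputSet, MvPolynomial.eval (Sum.elim (fun _ => t) (Sum.elim x u)) (P.f F.axis) ≠ 0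

/-- The operator `𝓛 v = ∂v/∂t + ∇ₓv · f`. -/
def lie (v : ZPoly P.n P.m) : ZPoly P.n P.m :=
  MvPolynomial.pderiv tv v + ∑ p, MvPolynomial.pderiv (xv p) v * P.f p

/-! ## The constraints of the relaxation -/

/-- The constraints of the split problem. Time intervals are numbered from `0` to `nt`. -/
inductive Con (P : SplitROA) : Type
  /-- `- 𝓛 v_{i,k} ≥ 0` on `[T_k, T_{k+1}] × X_i × U` -/
  | dyn (i : P.Cell) (k : Fin (P.nt + 1))
  /-- `w_i - v_{i,first}(0, ·) - 1 ≥ 0` on `X_i` -/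
  | init (i : P.Cell)
  /-- `v_{i,last}(T, ·) ≥ 0` on `X_T ∩ X_i` -/
  | term (i : P.Cell)
  /-- `w_i ≥ 0` on `X_i` -/
  | nonneg (i : P.Cell)
  /-- `v_{i,k}(T_{k+1}, ·) - v_{i,k+1}(T_{k+1}, ·) ≥ 0` on `X_i` -/
  | jump (i : P.Cell) (k : Fin P.nt)
  /-- `v_{a,k} - v_{b,k} ≥ 0` on `[T_k, T_{k+1}] × (X_a ∩ X_b) × U` where `hᵀf ≥ 0` -/
  | facetPos (F : P.Facet) (k : Fin (P.nt + 1))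
  /-- `v_{b,k} - v_{a,k} ≥ 0` on `[T_k, T_{k+1}] × (X_a ∩ X_b) × U` where `- hᵀf ≥ 0` -/
  | facetNeg (F : P.Facet) (k : Fin (P.nt + 1))
  deriving Fintype

/-- The labels of the polynomials that are multiplied by sums of squares in the constraints. -/
inductive Gen (P : SplitROA) : Type
  | one
  | time
  | axis (p : Fin P.n)
  | input (j : Fin P.nU)
  | target (j : Fin P.nXT)
  | flow
  | ball
  deriving Fintype

/-- The labels of the polynomials (other than `1`, the flow across a facet and a ball constraint)
which describe the set on which a constraint is imposed. -/
def Con.Describes {P : SplitROA} : P.Con → P.Gen → Prop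
  | .dyn _ _, .time => True
  | .dyn _ _, .axis _ => True
  | .dyn _ _, .input _ => True
  | .init _, .axis _ => True
  | .term _, .axis _ => True
  | .term _, .target _ => True
  | .nonneg _, .axis _ => True
  | .jump _ _, .axis _ => True
  | .facetPos _ _, .time => True
  | .facetPos F _, .axis p => p ≠ F.axis
  | .facetPos _ _, .input _ => True
  | .facetNeg _ _, .time => True
  | .facetNeg F _, .axis p => p ≠ F.axis
  | .facetNeg _ _, .input _ => True
  | _, _ => False

/-- The variables in which a constraint is written. On a facet the coordinate along the normal vector
is replaced by the position of the facet. -/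
def Con.vars {P : SplitROA} : P.Con → Finset (ZVar P.n P.m)
  | .dyn _ _ => Finset.univ
  | .init _ => xVars P.n P.m
  | .term _ => xVars P.n P.m
  | .nonneg _ => xVars P.n P.m
  | .jump _ _ => xVars P.n P.m
  | .facetPos F _ => Finset.univ.erase (xv F.axis)
  | .facetNeg F _ => Finset.univ.erase (xv F.axis)

/-- The cell of a constraint (the lower cell of a facet). -/
def Con.cell {P : SplitROA} : P.Con → P.Cell
  | .dyn i _ => i
  | .init i => i
  | .term i => i
  | .nonneg i => i
  | .jump i _ => i
  | .facetPos F _ => F.lower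
  | .facetNeg F _ => F.lower

/-- The polynomial `(t - T_k) (T_{k+1} - t)` of the time interval of a constraint; it is only used
for the constraints that involve time. -/
def Con.timePoly {P : SplitROA} (θ : P.Split → ℝ) : P.Con → ZPoly P.n P.m
  | .dyn _ k => intervalPoly tv (P.timeNode θ k.castSucc) (P.timeNode θ k.succ)
  | .facetPos _ k => intervalPoly tv (P.timeNode θ k.castSucc) (P.timeNode θ k.succ)
  | .facetNeg _ k => intervalPoly tv (P.timeNode θ k.castSucc) (P.timeNode θ k.succ)
  | _ => 0

/-- The polynomials `hᵀf` and `- hᵀf` on a facet; only used for the constraints on facets. -/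
def Con.flowPoly {P : SplitROA} (θ : P.Split → ℝ) : P.Con → ZPoly P.n P.m
  | .facetPos F _ => substVar (xv F.axis) (F.pos θ) (P.f F.axis)
  | .facetNeg F _ => - substVar (xv F.axis) (F.pos θ) (P.f F.axis)
  | _ => 0

/-- Whether a constraint is one of the two constraints on a facet. -/
def Con.IsFacet {P : SplitROA} : P.Con → Prop
  | .facetPos _ _ => True
  | .facetNeg _ _ => True
  | _ => False

/-- The polynomial which has to be nonnegative according to a constraint. -/
def Con.lhs {P : SplitROA} (θ : P.Split → ℝ)
    (v : P.Cell → Fin (P.nt + 1) → ZPoly P.n P.m) (w : P.Cell → ZPoly P.n P.m) :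
    P.Con → ZPoly P.n P.m
  | .dyn i k => - P.lie (v i k)
  | .init i => w i - substVar tv 0 (v i 0) - 1
  | .term i => substVar tv P.T (v i (Fin.last P.nt))
  | .nonneg i => w i
  | .jump i k => substVar tv (θ (Sum.inl k)) (v i k.castSucc - v i k.succ)
  | .facetPos F k => substVar (xv F.axis) (F.pos θ) (v F.lower k - v F.upper k)
  | .facetNeg F k => substVar (xv F.axis) (F.pos θ) (v F.upper k - v F.lower k)

/-- The polynomial with a given label in a constraint; `ρ` is the radius of the ball. -/
def Con.gen {P : SplitROA} (θ : P.Split → ℝ) (ρ : ℝ) (κ : P.Con) : P.Gen → ZPoly P.n P.m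
  | .one => 1
  | .time => κ.timePoly θ
  | .axis p => intervalPoly (xv p) (P.axisNode θ p (κ.cell p).castSucc)
      (P.axisNode θ p (κ.cell p).succ)
  | .input j => MvPolynomial.rename uv (P.gU j)
  | .target j => MvPolynomial.rename xv (P.gXT j)
  | .flow => κ.flowPoly θ
  | .ball => MvPolynomial.C (ρ ^ 2) - ∑ z ∈ κ.vars, MvPolynomial.X z ^ 2

/-- The set on which a constraint is imposed (for facets: before the sign condition on the flow), as
a cylinder over the variables of the constraint. -/
def Con.domain {P : SplitROA} (θ : P.Split → ℝ) (κ : P.Con) : Set (ZVar P.n P.m → ℝ) :=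
  {z | ∀ g, κ.Describes g → 0 ≤ MvPolynomial.eval z (κ.gen θ 0 g)}

/-- The choices that determine a sum-of-squares relaxation of the split problem: which sets get a
ball constraint (of which radius) added to their description, the relaxation order `d`, the degrees of
the polynomials `v_{i,k}` and `w_i`, and half the degree of each sum-of-squares multiplier. -/
structure Relaxation (P : SplitROA) where
  ball : P.Con → Option ℝ
  d : ℕ
  degV : P.Cell → Fin (P.nt + 1) → ℕ
  degW : P.Cell → ℕ
  half : P.Con → P.Gen → ℕ

namespace Relaxation

variable {P} (R : P.Relaxation)

/-- The multipliers that occur in a constraint. -/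
def Active (κ : P.Con) (g : P.Gen) : Prop :=
  g = .one ∨ κ.Describes g ∨ (g = .flow ∧ κ.IsFacet) ∨ (g = .ball ∧ (R.ball κ).isSome)

/-- The index type of the sum-of-squares multipliers. -/
def Block : Type := {B : P.Con × P.Gen // R.Active B.1 B.2}

instance : Finite R.Block := inferInstanceAs (Finite {B : P.Con × P.Gen // R.Active B.1 B.2})

instance : Fintype R.Block := Fintype.ofFinite _

/-- The multipliers of one constraint. -/
def blocksOf (κ : P.Con) : Finset R.Block :=
  letI : DecidablePred fun B : R.Block => B.1.1 = κ := Classical.decPred _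
  Finset.univ.filter fun B => B.1.1 = κ

/-- The polynomial which is multiplied by the sum of squares `B`. -/
def gen (θ : P.Split → ℝ) (B : R.Block) : ZPoly P.n P.m :=
  B.1.1.gen θ ((R.ball B.1.1).getD 0) B.1.2

/-- The degrees of all polynomials in the relaxation do not exceed the relaxation order. -/
def DegreesWithinOrder : Prop :=
  (∀ i k, R.degV i k ≤ R.d) ∧ (∀ i, R.degW i ≤ R.d) ∧
  (∀ i k v, IsPolyIn (txVars P.n P.m) (R.degV i k) v → (P.lie v).totalDegree ≤ R.d) ∧
  (∀ (θ : P.Split → ℝ) (B : R.Block), 2 * R.half B.1.1 B.1.2 + (R.gen θ B).totalDegree ≤ R.d)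

/-- Each set on which a constraint is imposed has a description with a ball constraint (a ball that
contains the set), or is described as a box, with a constraint `ρ² - (z - c)² ≥ 0` for each of its
coordinates `z`. -/
def BallConstraints (θ : P.Split → ℝ) : Prop :=
  ∀ κ : P.Con,
    (∃ ρ, R.ball κ = some ρ ∧ ∀ z ∈ κ.domain θ, ∑ i ∈ κ.vars, z i ^ 2 ≤ ρ ^ 2) ∨
    (R.ball κ = none ∧ ∀ i ∈ κ.vars, ∃ g, κ.Describes g ∧ ∃ ρ c : ℝ,
      κ.gen θ 0 g = MvPolynomial.C (ρ ^ 2) - (MvPolynomial.X i - MvPolynomial.C c) ^ 2)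

/-! ### The relaxation in terms of polynomials -/

/-- Feasibility of the polynomials `v_{i,k}`, `w_i` for the relaxation. -/
def Feasible (θ : P.Split → ℝ) (v : P.Cell → Fin (P.nt + 1) → ZPoly P.n P.m)
    (w : P.Cell → ZPoly P.n P.m) : Prop :=
  (∀ i k, IsPolyIn (txVars P.n P.m) (R.degV i k) (v i k)) ∧
  (∀ i, IsPolyIn (xVars P.n P.m) (R.degW i) (w i)) ∧
  ∃ q : R.Block → ZPoly P.n P.m,
    (∀ B, IsSOSIn B.1.1.vars (R.half B.1.1 B.1.2) (q B)) ∧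
    ∀ κ : P.Con, κ.lhs θ v w = ∑ B ∈ R.blocksOf κ, q B * R.gen θ B

/-- The objective: the coefficients of `w_i` times the Lebesgue moments of `X_i`, summed over `i`. -/
def cost (P : SplitROA) (θ : P.Split → ℝ) (w : P.Cell → ZPoly P.n P.m) : ℝ :=
  ∑ i, ∑ e ∈ (w i).support, (w i).coeff e * P.moment θ i e

/-- The objective values of the feasible points. -/
def costs (θ : P.Split → ℝ) : Set ℝ := {a | ∃ v w, R.Feasible θ v w ∧ cost P θ w = a}

/-- The infimum of the relaxation, as a function of the split positions. -/
def value (θ : P.Split → ℝ) : ℝ := sInf (R.costs θ)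

/-! ### The relaxation as a semidefinite program -/

/-- The rows and columns of the Gram matrix of a multiplier. -/
abbrev BlockIdx (B : R.Block) : Type := Mono B.1.1.vars (R.half B.1.1 B.1.2)

/-- The decision variables: the coefficients of all `v_{i,k}` and `w_i`, and the entries of the Gram
matrices of the multipliers. -/
abbrev DecVar : Type :=
  (Σ ik : P.Cell × Fin (P.nt + 1), Mono (txVars P.n P.m) (R.degV ik.1 ik.2)) ⊕
  (Σ i : P.Cell, Mono (xVars P.n P.m) (R.degW i)) ⊕
  (Σ B : R.Block, Sym2 (R.BlockIdx B))

variable {R} in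
/-- The polynomials `v_{i,k}` given by the decision variables. -/
def polyV (x : R.DecVar → ℝ) (i : P.Cell) (k : Fin (P.nt + 1)) : ZPoly P.n P.m :=
  ∑ e : Mono (txVars P.n P.m) (R.degV i k), MvPolynomial.monomial e.1 (x (Sum.inl ⟨(i, k), e⟩))

variable {R} in
/-- The polynomials `w_i` given by the decision variables. -/
def polyW (x : R.DecVar → ℝ) (i : P.Cell) : ZPoly P.n P.m :=
  ∑ e : Mono (xVars P.n P.m) (R.degW i), MvPolynomial.monomial e.1 (x (Sum.inr (Sum.inl ⟨i, e⟩)))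

variable {R} in
/-- The multipliers given by the decision variables. -/
def polyQ (x : R.DecVar → ℝ) (B : R.Block) : ZPoly P.n P.m :=
  gramPoly (smat fun e : Sym2 (R.BlockIdx B) => x (Sum.inr (Sum.inr ⟨B, e⟩)))

/-- The difference of the two sides of a constraint. -/
def residual (θ : P.Split → ℝ) (κ : P.Con) (x : R.DecVar → ℝ) : ZPoly P.n P.m :=
  κ.lhs θ (polyV x) (polyW x) - ∑ B ∈ R.blocksOf κ, polyQ x B * R.gen θ B

/-- The equality rows: one for each constraint and each monomial that can occur in it. Coefficient
equations which are void (`0 = 0` for all split positions) are not part of the program. -/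
def EqRow : Type :=
  {E : P.Con × (ZVar P.n P.m →₀ ℕ) //
    E.2.degree ≤ R.d ∧ ∃ θ x, (R.residual θ E.1 x).coeff E.2 ≠ 0}

instance : Finite R.EqRow :=
  ((Set.finite_univ.prod (Finsupp.finite_of_degree_le (σ := ZVar P.n P.m) R.d)).subset
    (fun _ h => Set.mk_mem_prod (Set.mem_univ _) h.1 :
      {E : P.Con × (ZVar P.n P.m →₀ ℕ) |
        E.2.degree ≤ R.d ∧ ∃ θ x, (R.residual θ E.1 x).coeff E.2 ≠ 0} ⊆ _)).to_subtype

instance : Fintype R.EqRow := Fintype.ofFinite _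

/-- The semidefinite program `min cᵀx  s.t.  A x + s = b, s ∈ K` of the relaxation. The equality rows
compare coefficients in the constraints, and the other rows state that the slack matrices are the Gram
matrices. -/
def sdp (θ : P.Split → ℝ) : ConicSDP R.DecVar R.EqRow R.Block R.BlockIdx where
  A := Matrix.of fun row j =>
    letI : DecidableEq R.DecVar := Classical.decEq _
    match row with
    | Sum.inl E => (R.residual θ E.1.1 (Pi.single j 1)).coeff E.1.2 -
        (R.residual θ E.1.1 0).coeff E.1.2
    | Sum.inr e => if j = Sum.inr (Sum.inr e) then -1 else 0
  b := fun row =>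
    match row with
    | Sum.inl E => - (R.residual θ E.1.1 0).coeff E.1.2
    | Sum.inr _ => 0
  c := fun j =>
    match j with
    | Sum.inr (Sum.inl ⟨i, e⟩) => P.moment θ i e.1
    | _ => 0

end Relaxation

end SplitROA

end

/-! The value is differentiable for the reason behind the envelope theorem, applied to the conic
form of the relaxation. Write L(x, y) = cᵀx - (b - Ax)ᵀy for the Lagrangian. If (x, y) and (x', y')
are primal-dual pairs without gap for data D and D', then weak duality gives L_{D'}(x', y) - L_D(x',
y) ≤ p(D') - p(D) ≤ L_{D'}(x, y') - L_D(x, y'). Both bounds are sums of increments of the data,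
weighted with entries or products of entries of the solutions. If x' → x and y' → y as D' → D, the
bounds have the same derivative, and p is squeezed between them. The solutions need only converge;
no implicit function theorem for the optimality conditions is involved (`hasFDerivWithinAt_sub_mul`,
`hasFDerivWithinAt_of_squeeze`).

Existence and convergence of nearby solutions come from one property of the data: the homogeneous
optimality system has only the zero solution (`Nondegenerate`). It follows from uniqueness of the
primal-dual solution, because a nonzero homogeneous solution is a direction along which a primal or
a dual optimum could be moved (`nondegenerate_of_unique`). By compactness it is an estimate δ‖z‖ ≤
‖L z‖ on the cone, uniform for nearby data (`Nondegenerate.eventually_bound`). The estimate makes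
the image of the cone closed, so that separation yields solutions with zero gap (`exists_isSaddle`),
and it bounds them, so that uniqueness forces convergence (`exists_tendsto_isSaddle`).

For the relaxation it remains to see that the polynomial problem and its semidefinite program have
the same objective values (`costs_eq`), and that the data depend smoothly on the split positions:
the entries of A and b are coefficients of polynomials in which the positions are substituted, and
on ordered positions the moments are polynomials in them (`moment_eq`). -/

noncomputable section

/-! ## Stability of conic programs -/

namespace ConicStability

open Matrix

variable {N ρ : Type*} [Fintype N] [Fintype ρ]

/-- The dual of a cone with respect to the dot product. -/
def dotDual (K : PointedCone ℝ (ρ → ℝ)) : PointedCone ℝ (ρ → ℝ) where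
  carrier := {y | ∀ s ∈ K, 0 ≤ s ⬝ᵥ y}
  add_mem' := fun ha hb s hs => by
    rw [dotProduct_add]; exact add_nonneg (ha s hs) (hb s hs)
  zero_mem' := fun s _ => by simp
  smul_mem' := fun r y hy s hs => by
    have : r • y = (r : ℝ) • y := rfl
    rw [this, dotProduct_smul]; exact mul_nonneg r.2 (hy s hs)

lemma mem_dotDual {K : PointedCone ℝ (ρ → ℝ)} {y : ρ → ℝ} :
    y ∈ dotDual K ↔ ∀ s ∈ K, 0 ≤ s ⬝ᵥ y := Iff.rfl

lemma isClosed_dotDual (K : PointedCone ℝ (ρ → ℝ)) : IsClosed (dotDual K : Set (ρ → ℝ)) := by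
  have : (dotDual K : Set (ρ → ℝ)) = ⋂ s ∈ K, {y | 0 ≤ s ⬝ᵥ y} := by
    ext y; simp [mem_dotDual]
  rw [this]
  exact isClosed_biInter fun s _ => isClosed_le continuous_const (by fun_prop)

lemma exists_dotProduct_eq (f : (ρ → ℝ) →ₗ[ℝ] ℝ) : ∃ η : ρ → ℝ, ∀ a, f a = a ⬝ᵥ η := by
  classical
  refine ⟨fun i => f (Pi.single i 1), fun a => ?_⟩
  rw [LinearMap.pi_apply_eq_sum_univ f a]
  simp only [dotProduct, smul_eq_mul]
  refine Finset.sum_congr rfl fun i _ => ?_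
  congr 2; ext j; simp [Pi.single_apply, eq_comm]

/-- Bipolar theorem: a point outside a closed convex cone is separated from it by an element of the
dual cone. -/
lemma mem_of_forall_dotDual {K : PointedCone ℝ (ρ → ℝ)} (hK : IsClosed (K : Set (ρ → ℝ)))
    {s : ρ → ℝ} (h : ∀ y ∈ dotDual K, 0 ≤ s ⬝ᵥ y) : s ∈ K := by
  by_contra hs
  obtain ⟨f, hf, hfs⟩ :=
    ProperCone.hyperplane_separation_point (⟨K, hK⟩ : ProperCone ℝ (ρ → ℝ)) (x₀ := s) hs
  obtain ⟨η, hη⟩ := exists_dotProduct_eq f.toLinearMap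
  have hη' : ∀ a, f a = a ⬝ᵥ η := hη
  have := h η fun a ha => by rw [← hη']; exact hf a ha
  rw [← hη'] at this
  linarith

/-- The image of a closed cone under a linear map which is injective at `0` on the cone. -/
lemma isClosed_image_of_forall_bound {Z F : Type*} [NormedAddCommGroup Z] [NormedSpace ℝ Z]
    [ProperSpace Z] [NormedAddCommGroup F] [NormedSpace ℝ F] {C : Set Z} (hC : IsClosed C)
    (L : Z →L[ℝ] F) {δ : ℝ} (hδ : 0 < δ) (h : ∀ z ∈ C, δ * ‖z‖ ≤ ‖L z‖) :
    IsClosed (L '' C) := by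
  refine IsSeqClosed.isClosed fun u y hu huy => ?_
  choose z hz hzu using hu
  obtain ⟨M, hM⟩ := (Metric.isBounded_range_of_tendsto u huy).exists_norm_le
  -- A convergent sequence of images is bounded, hence by the estimate so are the preimages, and a
  -- subsequence of these converges in `C`.
  have hb : ∀ n, z n ∈ Metric.closedBall (0 : Z) (M / δ) := fun n => by
    rw [mem_closedBall_zero_iff, le_div_iff₀ hδ, mul_comm]
    exact (h _ (hz n)).trans (hzu n ▸ hM _ (Set.mem_range_self n))
  obtain ⟨a, -, φ, hφ, ha⟩ := (isCompact_closedBall (0 : Z) (M / δ)).tendsto_subseq hb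
  refine ⟨a, hC.mem_of_tendsto ha (Eventually.of_forall fun n => hz _), ?_⟩
  refine tendsto_nhds_unique ((L.continuous.tendsto a).comp ha) ?_
  simpa [Function.comp_def, hzu] using huy.comp hφ.tendsto_atTop

/-! ### The optimality system, its nondegeneracy, and existence of solutions -/

variable (N ρ) in
/-- The data of a conic program `min cᵀx  s.t.  b - A x ∈ K`. -/
abbrev Data : Type _ := Matrix ρ N ℝ × (ρ → ℝ) × (N → ℝ)

variable (N ρ) in
/-- The variables of the optimality system: primal variables, dual variables, slacks, and the slack
of the duality gap. -/
abbrev Vars : Type _ := (N → ℝ) × (ρ → ℝ) × (ρ → ℝ) × ℝ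

/-- The linear part of the optimality system. -/
def optMap (D : Data N ρ) : Vars N ρ →ₗ[ℝ] (ρ → ℝ) × (N → ℝ) × ℝ where
  toFun z := (D.1 *ᵥ z.1 + z.2.2.1, D.1.transpose *ᵥ z.2.1, D.2.2 ⬝ᵥ z.1 + D.2.1 ⬝ᵥ z.2.1 + z.2.2.2)
  map_add' z z' := by
    ext
    · simp [mulVec_add]; ring
    · simp [mulVec_add]
    · simp [dotProduct_add]; ring
  map_smul' r z := by
    ext
    · simp [mulVec_smul]
    · simp [mulVec_smul]
    · simp [dotProduct_smul]; ring

lemma optMap_apply (D : Data N ρ) (z : Vars N ρ) : optMap D z =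
    (D.1 *ᵥ z.1 + z.2.2.1, D.1.transpose *ᵥ z.2.1, D.2.2 ⬝ᵥ z.1 + D.2.1 ⬝ᵥ z.2.1 + z.2.2.2) := rfl

/-- The conic constraints of the optimality system. -/
def optCone (N : Type*) (K : PointedCone ℝ (ρ → ℝ)) : PointedCone ℝ (Vars N ρ) :=
  Submodule.prod ⊤ ((dotDual K).prod (K.prod (PointedCone.positive ℝ ℝ)))

lemma mem_optCone {N : Type*} {K : PointedCone ℝ (ρ → ℝ)} {z : Vars N ρ} :
    z ∈ optCone N K ↔ z.2.1 ∈ dotDual K ∧ z.2.2.1 ∈ K ∧ 0 ≤ z.2.2.2 := by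
  simp [optCone, Submodule.mem_prod]

lemma isClosed_optCone {N : Type*} {K : PointedCone ℝ (ρ → ℝ)} (hK : IsClosed (K : Set (ρ → ℝ))) :
    IsClosed (optCone N K : Set (Vars N ρ)) := by
  have : (optCone N K : Set (Vars N ρ)) =
      {z | z.2.1 ∈ (dotDual K : Set (ρ → ℝ))} ∩ ({z | z.2.2.1 ∈ (K : Set (ρ → ℝ))} ∩
        {z | 0 ≤ z.2.2.2}) := by
    ext z; exact mem_optCone
  rw [this]
  exact ((isClosed_dotDual K).preimage (by fun_prop)).inter
    ((hK.preimage (by fun_prop)).inter (isClosed_le continuous_const (by fun_prop)))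

/-- The homogeneous optimality system has only the trivial solution. -/
def Nondegenerate (K : PointedCone ℝ (ρ → ℝ)) (D : Data N ρ) : Prop :=
  ∀ z ∈ optCone N K, optMap D z = 0 → z = 0

/-- `x` and `y` satisfy the optimality conditions of the primal-dual pair. -/
def IsSaddle (K : PointedCone ℝ (ρ → ℝ)) (D : Data N ρ) (x : N → ℝ) (y : ρ → ℝ) : Prop :=
  D.2.1 - D.1 *ᵥ x ∈ K ∧ y ∈ dotDual K ∧ D.1.transpose *ᵥ y + D.2.2 = 0 ∧
    D.2.2 ⬝ᵥ x + D.2.1 ⬝ᵥ y ≤ 0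

lemma dotProduct_transpose_mulVec (A : Matrix ρ N ℝ) (x : N → ℝ) (y : ρ → ℝ) :
    x ⬝ᵥ (Aᵀ *ᵥ y) = (A *ᵥ x) ⬝ᵥ y := by
  rw [mulVec_transpose, dotProduct_comm, dotProduct_comm (A *ᵥ x), dotProduct_mulVec]

/-- The gap between the primal and the dual objective values. -/
lemma gap_eq (D : Data N ρ) (x : N → ℝ) {y : ρ → ℝ} (hy : D.1.transpose *ᵥ y + D.2.2 = 0) :
    D.2.2 ⬝ᵥ x + D.2.1 ⬝ᵥ y = (D.2.1 - D.1 *ᵥ x) ⬝ᵥ y := by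
  rw [eq_neg_of_add_eq_zero_right hy, sub_dotProduct, ← dotProduct_transpose_mulVec,
    neg_dotProduct, dotProduct_comm x]
  ring

lemma gap_nonneg {K : PointedCone ℝ (ρ → ℝ)} {D : Data N ρ} {x : N → ℝ} {y : ρ → ℝ}
    (hx : D.2.1 - D.1 *ᵥ x ∈ K) (hy : D.1.transpose *ᵥ y + D.2.2 = 0) (hyK : y ∈ dotDual K) :
    0 ≤ D.2.2 ⬝ᵥ x + D.2.1 ⬝ᵥ y :=
  gap_eq D x hy ▸ hyK _ hx

lemma IsSaddle.gap {K : PointedCone ℝ (ρ → ℝ)} {D : Data N ρ} {x : N → ℝ} {y : ρ → ℝ}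
    (h : IsSaddle K D x y) : D.2.2 ⬝ᵥ x + D.2.1 ⬝ᵥ y = 0 :=
  le_antisymm h.2.2.2 (gap_nonneg h.1 h.2.2.1 h.2.1)

/-- Turns optimality into membership of (b, -c, 0) in the linear image of a cone. The variable κ ≥ 0
encodes that the gap is at most 0; by weak duality it must vanish. -/
lemma isSaddle_iff {K : PointedCone ℝ (ρ → ℝ)} {D : Data N ρ} {x : N → ℝ} {y : ρ → ℝ} :
    IsSaddle K D x y ↔ ∃ s κ, (x, y, s, κ) ∈ optCone N K ∧
      optMap D (x, y, s, κ) = (D.2.1, -D.2.2, 0) := by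
  simp only [mem_optCone, optMap_apply, Prod.mk.injEq]
  constructor
  · intro h
    exact ⟨D.2.1 - D.1 *ᵥ x, 0, ⟨h.2.1, h.1, le_rfl⟩, by abel, eq_neg_of_add_eq_zero_left h.2.2.1,
      by rw [h.gap, add_zero]⟩
  · rintro ⟨s, κ, ⟨hy, hs, hκ⟩, h1, h2, h3⟩
    refine ⟨?_, hy, by rw [h2]; abel, by linarith⟩
    rw [← h1]; simpa using hs

/-- A quantitative form of nondegeneracy, which holds uniformly for nearby data. -/
lemma Nondegenerate.eventually_bound {K : PointedCone ℝ (ρ → ℝ)}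
    (hK : IsClosed (K : Set (ρ → ℝ))) {D : Data N ρ} (h : Nondegenerate K D) :
    ∃ δ > 0, ∀ᶠ D' in 𝓝 D, ∀ z ∈ optCone N K, δ * ‖z‖ ≤ ‖optMap D' z‖ := by
  have hcont : Continuous fun p : Data N ρ × Vars N ρ => ‖optMap p.1 p.2‖ := by
    simp only [optMap_apply]
    refine continuous_norm.comp ?_
    have hA : Continuous fun p : Data N ρ × Vars N ρ => p.1.1 := continuous_fst.comp continuous_fst
    refine Continuous.prodMk ?_ (Continuous.prodMk ?_ ?_)
    · exact (hA.matrix_mulVec (by fun_prop)).add (by fun_prop)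
    · exact hA.matrix_transpose.matrix_mulVec (by fun_prop)
    · exact ((Continuous.dotProduct (by fun_prop) (by fun_prop)).add
        (Continuous.dotProduct (by fun_prop) (by fun_prop))).add (by fun_prop)
  have hS : IsCompact (Metric.sphere (0 : Vars N ρ) 1 ∩ optCone N K) :=
    (isCompact_sphere _ _).inter_right (isClosed_optCone hK)
  obtain ⟨δ, hδ, hb⟩ : ∃ δ > 0, ∀ z ∈ Metric.sphere (0 : Vars N ρ) 1 ∩ optCone N K,
      δ < ‖optMap D z‖ := by
    rcases (Metric.sphere (0 : Vars N ρ) 1 ∩ optCone N K).eq_empty_or_nonempty with he | hne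
    · exact ⟨1, one_pos, by simp [he]⟩
    · obtain ⟨z₀, hz₀, hmin⟩ := hS.exists_isMinOn hne
        (hcont.comp (Continuous.prodMk_right D)).continuousOn
      have hpos : 0 < ‖optMap D z₀‖ := by
        rw [norm_pos_iff]
        intro h0
        have hn : ‖z₀‖ = 1 := by simpa using hz₀.1
        rw [h z₀ hz₀.2 h0, norm_zero] at hn
        exact zero_ne_one hn
      exact ⟨‖optMap D z₀‖ / 2, half_pos hpos,
        fun z hz => (half_lt_self hpos).trans_le (hmin hz)⟩
  refine ⟨δ, hδ, ?_⟩
  -- A strict inequality on a compact set persists for nearby data; this is why δ was taken as half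
  -- of the minimum. Homogeneity then carries it from the unit sphere to the whole cone.
  have := hS.eventually_forall_of_forall_eventually (x₀ := D)
    (P := fun D' z => δ < ‖optMap D' z‖)
    fun z hz => (hcont.tendsto (D, z)).eventually (lt_mem_nhds (hb z hz))
  filter_upwards [this] with D' hD' z hz
  rcases eq_or_ne z 0 with rfl | hz0
  · simp
  have hn : 0 < ‖z‖ := norm_pos_iff.2 hz0
  have h1 := hD' (‖z‖⁻¹ • z) ⟨by simp [norm_smul, hn.ne'],
    (optCone N K).smul_mem (inv_nonneg.2 hn.le) hz⟩
  rw [map_smul, norm_smul, norm_inv, norm_norm, inv_mul_eq_div, lt_div_iff₀ hn] at h1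
  exact h1.le

/-- Existence of primal-dual solutions without duality gap. -/
lemma exists_isSaddle {K : PointedCone ℝ (ρ → ℝ)} (hK : IsClosed (K : Set (ρ → ℝ)))
    {D : Data N ρ} {δ : ℝ} (hδ : 0 < δ) (h : ∀ z ∈ optCone N K, δ * ‖z‖ ≤ ‖optMap D z‖) :
    ∃ x y, IsSaddle K D x y := by
  set L : Vars N ρ →L[ℝ] (ρ → ℝ) × (N → ℝ) × ℝ := (optMap D).toContinuousLinearMap with hL
  have hLa : ∀ z, L z = optMap D z := fun z => rfl
  have hcl : IsClosed (L '' (optCone N K : Set (Vars N ρ))) :=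
    isClosed_image_of_forall_bound (isClosed_optCone hK) L hδ h
  let M : ProperCone ℝ ((ρ → ℝ) × (N → ℝ) × ℝ) :=
    ⟨(optCone N K).map L.toLinearMap, hcl⟩
  have hM : ∀ z, z ∈ M ↔ ∃ w ∈ optCone N K, optMap D w = z := fun z => Iff.rfl
  by_contra hno
  push Not at hno
  -- Without a saddle point, the right-hand side is outside the closed image cone. The separating
  -- functional has components (η, ξ, σ), and testing it on each variable separately gives the sign
  -- conditions below.
  have hnot : (D.2.1, -D.2.2, (0 : ℝ)) ∉ M := by
    rw [hM]
    rintro ⟨⟨x, y, s, κ⟩, hw, hw'⟩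
    exact hno x y (isSaddle_iff.2 ⟨s, κ, hw, hw'⟩)
  obtain ⟨f, hf, hft⟩ := ProperCone.hyperplane_separation_point M hnot
  obtain ⟨η, hη⟩ := exists_dotProduct_eq (f.toLinearMap ∘ₗ LinearMap.inl ℝ _ _)
  obtain ⟨ξ, hξ⟩ := exists_dotProduct_eq
    (f.toLinearMap ∘ₗ LinearMap.inr ℝ _ _ ∘ₗ LinearMap.inl ℝ (N → ℝ) ℝ)
  set σ : ℝ := f (0, 0, 1) with hσ
  have hfe : ∀ a b r, f (a, b, r) = a ⬝ᵥ η + b ⬝ᵥ ξ + r * σ := fun a b r => by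
    rw [← hη, ← hξ, hσ, ← smul_eq_mul, ← map_smul]
    simp only [LinearMap.comp_apply, LinearMap.inl_apply, LinearMap.inr_apply,
      ContinuousLinearMap.coe_coe, ← map_add]
    congr 1; ext <;> simp
  have key : ∀ x, ∀ y ∈ dotDual K, ∀ s ∈ K, ∀ κ : ℝ, 0 ≤ κ →
      0 ≤ (D.1 *ᵥ x + s) ⬝ᵥ η + (D.1.transpose *ᵥ y) ⬝ᵥ ξ + (D.2.2 ⬝ᵥ x + D.2.1 ⬝ᵥ y + κ) * σ :=
    fun x y hy s hs κ hκ => by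
      rw [← hfe]
      exact hf _ ((hM _).2 ⟨(x, y, s, κ), mem_optCone.2 ⟨hy, hs, hκ⟩, rfl⟩)
  have hσ0 : 0 ≤ σ := by simpa using key 0 0 (zero_mem _) 0 (zero_mem _) 1 zero_le_one
  have hηK : η ∈ dotDual K := fun s hs => by simpa using key 0 0 (zero_mem _) s hs 0 le_rfl
  have hxx : D.1.transpose *ᵥ η + σ • D.2.2 = 0 := by
    have hlin : ∀ x, 0 ≤ x ⬝ᵥ (D.1.transpose *ᵥ η + σ • D.2.2) := fun x => by
      have := key x 0 (zero_mem _) 0 (zero_mem _) 0 le_rfl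
      simp only [add_zero, mulVec_zero, zero_dotProduct, dotProduct_zero] at this
      rw [dotProduct_add, dotProduct_transpose_mulVec, dotProduct_smul, smul_eq_mul,
        dotProduct_comm x]
      linarith
    -- A linear form that is nowhere negative vanishes; testing at the negative of its own
    -- coefficient vector shows this.
    have h1 := hlin (-(D.1.transpose *ᵥ η + σ • D.2.2))
    rw [neg_dotProduct] at h1
    exact dotProduct_self_eq_zero.1 (le_antisymm (by linarith) (hlin _))
  have hξK : D.1 *ᵥ ξ + σ • D.2.1 ∈ K := by
    refine mem_of_forall_dotDual hK fun y hy => ?_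
    have := key 0 y hy 0 (zero_mem _) 0 le_rfl
    simp only [add_zero, mulVec_zero, zero_dotProduct, dotProduct_zero, zero_add] at this
    rw [add_dotProduct, ← dotProduct_transpose_mulVec, smul_dotProduct, smul_eq_mul,
      dotProduct_comm ξ]
    linarith
  rw [hfe, neg_dotProduct, zero_mul, add_zero] at hft
  rcases hσ0.eq_or_lt with h0 | hpos
  -- If σ = 0, the functional itself is a solution of the homogeneous system whose last component is
  -- positive, against the estimate `h`.
  · rw [← h0, zero_smul, add_zero] at hxx hξK
    set z : Vars N ρ := (-ξ, η, D.1 *ᵥ ξ, D.2.2 ⬝ᵥ ξ - D.2.1 ⬝ᵥ η) with hz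
    have hz0 := h z (mem_optCone.2 ⟨hηK, hξK, by simp only [hz]; linarith⟩)
    have : optMap D z = 0 := by
      simp only [optMap_apply, hz, hxx, mulVec_neg, dotProduct_neg, Prod.mk_eq_zero]
      exact ⟨by simp, by simp, by ring⟩
    rw [this, norm_zero] at hz0
    have hzn : z = 0 := norm_le_zero_iff.1 (nonpos_of_mul_nonpos_right hz0 hδ)
    have : D.2.2 ⬝ᵥ ξ - D.2.1 ⬝ᵥ η = 0 := congrArg (fun w : Vars N ρ => w.2.2.2) hzn
    linarith
  -- If σ > 0, then -ξ/σ and η/σ are primal and dual feasible with negative gap, against weak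
  -- duality; the computation is this one multiplied by σ².
  · have h1 := hηK _ hξK
    rw [add_dotProduct, ← dotProduct_transpose_mulVec, eq_neg_of_add_eq_zero_left hxx,
      dotProduct_neg, dotProduct_smul, smul_dotProduct, smul_eq_mul, smul_eq_mul,
      dotProduct_comm ξ] at h1
    have : σ * (D.2.1 ⬝ᵥ η + -(D.2.2 ⬝ᵥ ξ)) < 0 := mul_neg_of_pos_of_neg hpos hft
    linarith

lemma isClosed_setOf_isSaddle {K : PointedCone ℝ (ρ → ℝ)} (hK : IsClosed (K : Set (ρ → ℝ))) :
    IsClosed {p : Data N ρ × (N → ℝ) × (ρ → ℝ) | IsSaddle K p.1 p.2.1 p.2.2} := by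
  have hA : Continuous fun p : Data N ρ × (N → ℝ) × (ρ → ℝ) => p.1.1 :=
    continuous_fst.comp continuous_fst
  have h1 : Continuous fun p : Data N ρ × (N → ℝ) × (ρ → ℝ) => p.1.2.1 - p.1.1 *ᵥ p.2.1 :=
    (by fun_prop : Continuous fun p : Data N ρ × (N → ℝ) × (ρ → ℝ) => p.1.2.1).sub
      (hA.matrix_mulVec (by fun_prop))
  have h2 : Continuous fun p : Data N ρ × (N → ℝ) × (ρ → ℝ) => p.1.1.transpose *ᵥ p.2.2 + p.1.2.2 :=
    (hA.matrix_transpose.matrix_mulVec (by fun_prop)).add (by fun_prop)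
  have h3 : Continuous fun p : Data N ρ × (N → ℝ) × (ρ → ℝ) =>
      p.1.2.2 ⬝ᵥ p.2.1 + p.1.2.1 ⬝ᵥ p.2.2 :=
    (Continuous.dotProduct (by fun_prop) (by fun_prop)).add
      (Continuous.dotProduct (by fun_prop) (by fun_prop))
  exact (hK.preimage h1).inter (((isClosed_dotDual K).preimage (by fun_prop)).inter
    ((isClosed_eq h2 continuous_const).inter (isClosed_le h3 continuous_const)))

/-- Near nondegenerate data with a unique primal-dual solution, primal-dual solutions exist and
converge. -/
lemma exists_tendsto_isSaddle {ι : Type*} {l : Filter ι} {K : PointedCone ℝ (ρ → ℝ)}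
    (hK : IsClosed (K : Set (ρ → ℝ))) {D₀ : Data N ρ} (hD₀ : Nondegenerate K D₀)
    {x₀ : N → ℝ} {y₀ : ρ → ℝ} (huniq : ∀ x y, IsSaddle K D₀ x y → x = x₀ ∧ y = y₀)
    {D : ι → Data N ρ} (hD : Tendsto D l (𝓝 D₀)) :
    ∃ (X : ι → N → ℝ) (Y : ι → ρ → ℝ), (∀ᶠ e in l, IsSaddle K (D e) (X e) (Y e)) ∧
      Tendsto X l (𝓝 x₀) ∧ Tendsto Y l (𝓝 y₀) := by
  classical
  obtain ⟨δ, hδ, hb⟩ := hD₀.eventually_bound hK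
  have hb' := hD.eventually hb
  have hex : ∀ e, ∃ p : (N → ℝ) × (ρ → ℝ),
      (∀ z ∈ optCone N K, δ * ‖z‖ ≤ ‖optMap (D e) z‖) → IsSaddle K (D e) p.1 p.2 := fun e => by
    by_cases h : ∀ z ∈ optCone N K, δ * ‖z‖ ≤ ‖optMap (D e) z‖
    · obtain ⟨x, y, hxy⟩ := exists_isSaddle hK hδ h
      exact ⟨(x, y), fun _ => hxy⟩
    · exact ⟨0, fun h' => absurd h' h⟩
  choose f hf using hex
  have hsad : ∀ᶠ e in l, IsSaddle K (D e) (f e).1 (f e).2 := hb'.mono fun e he => hf e he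
  set t : Data N ρ → (ρ → ℝ) × (N → ℝ) × ℝ := fun D => (D.2.1, -D.2.2, 0) with ht
  have htc : Continuous fun D : Data N ρ => ‖t D‖ := by
    refine continuous_norm.comp (Continuous.prodMk (by fun_prop)
      (Continuous.prodMk ?_ (by fun_prop)))
    exact (by fun_prop : Continuous fun D : Data N ρ => D.2.2).neg
  have hbd : ∀ᶠ e in l, ‖t (D e)‖ < ‖t D₀‖ + 1 :=
    ((htc.tendsto D₀).comp hD).eventually (gt_mem_nhds (lt_add_one _))
  -- The estimate bounds solutions by the right-hand side (b, -c, 0) of the optimality system, which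
  -- stays bounded.
  have hmem : ∀ᶠ e in l, f e ∈ Metric.closedBall (0 : (N → ℝ) × (ρ → ℝ)) ((‖t D₀‖ + 1) / δ) := by
    filter_upwards [hb', hsad, hbd] with e he hs hte
    obtain ⟨s, κ, hz, hz'⟩ := isSaddle_iff.1 hs
    have h1 := he _ hz
    rw [hz'] at h1
    have h2 : ‖f e‖ ≤ ‖((f e).1, (f e).2, s, κ)‖ := by
      simp only [Prod.norm_def]
      exact max_le_max le_rfl (le_max_left _ _)
    rw [mem_closedBall_zero_iff, le_div_iff₀ hδ, mul_comm]
    exact ((mul_le_mul_of_nonneg_left h2 hδ.le).trans h1).trans hte.le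
  have hlim : Tendsto f l (𝓝 (x₀, y₀)) := by
    -- Every cluster point solves the limit problem, since the saddle relation is closed jointly in
    -- data and solution; so there is only one.
    refine (isCompact_closedBall (0 : (N → ℝ) × (ρ → ℝ)) _).tendsto_nhds_of_unique_mapClusterPt
      hmem fun p _ hp => ?_
    obtain ⟨U, hU, hUp⟩ := mapClusterPt_iff_ultrafilter.1 hp
    have := (isClosed_setOf_isSaddle hK).mem_of_tendsto
      ((hD.mono_left hU).prodMk_nhds hUp) (hsad.filter_mono hU)
    exact Prod.ext_iff.2 (huniq p.1 p.2 this)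
  exact ⟨fun e => (f e).1, fun e => (f e).2, hsad,
    (continuous_fst.tendsto _).comp hlim, (continuous_snd.tendsto _).comp hlim⟩

/-! ### Sensitivity of the optimal value -/

variable {E : Type*} [NormedAddCommGroup E] [NormedSpace ℝ E]

/-- The first factor is O(e - θ), so replacing g by its limit costs only o(e - θ). No
differentiability of g is needed, which lets g be an entry of a merely convergent solution. -/
lemma hasFDerivWithinAt_sub_mul {φ g : E → ℝ} {φ' : E →L[ℝ] ℝ} {S : Set E} {θ : E} {a : ℝ}
    (hφ : HasFDerivWithinAt φ φ' S θ) (hg : Tendsto g (𝓝[S] θ) (𝓝 a)) :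
    HasFDerivWithinAt (fun e => (φ e - φ θ) * g e) (a • φ') S θ := by
  rw [hasFDerivWithinAt_iff_isLittleO] at hφ ⊢
  have h1 : (fun e => (φ e - φ θ - φ' (e - θ)) * g e) =o[𝓝[S] θ] fun e => e - θ := by
    simpa using (hφ.norm_right.mul_isBigO (hg.isBigO_one ℝ)).norm_right
  have h2 : (fun e => φ' (e - θ) * (g e - a)) =o[𝓝[S] θ] fun e => e - θ := by
    have hga : (fun e => g e - a) =o[𝓝[S] θ] fun _ => (1 : ℝ) := by
      rw [Asymptotics.isLittleO_one_iff]
      simpa using hg.sub_const a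
    simpa using (((φ'.isBigO_comp (fun e => e - θ) (𝓝[S] θ)).norm_right).mul_isLittleO
      hga).norm_right
  refine (h1.add h2).congr_left fun e => ?_
  simp only [sub_self, zero_mul, sub_zero, _root_.smul_apply, smul_eq_mul]
  ring

lemma hasFDerivWithinAt_of_squeeze {p lo up : E → ℝ} {L : E →L[ℝ] ℝ} {S : Set E} {θ : E}
    (hlo : HasFDerivWithinAt lo L S θ) (hup : HasFDerivWithinAt up L S θ)
    (hlo0 : lo θ = 0) (hup0 : up θ = 0)
    (h : ∀ᶠ e in 𝓝[S] θ, lo e ≤ p e - p θ ∧ p e - p θ ≤ up e) :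
    HasFDerivWithinAt p L S θ := by
  rw [hasFDerivWithinAt_iff_isLittleO] at hlo hup ⊢
  refine Asymptotics.IsBigO.trans_isLittleO ?_ (hlo.norm_left.add hup.norm_left)
  refine Asymptotics.IsBigO.of_bound 1 (h.mono fun e he => ?_)
  simp only [hlo0, hup0, sub_zero, Real.norm_eq_abs, one_mul]
  rw [abs_of_nonneg (add_nonneg (abs_nonneg (lo e - L (e - θ))) (abs_nonneg (up e - L (e - θ)))),
    abs_le]
  have h1 := neg_abs_le (lo e - L (e - θ))
  have h2 := le_abs_self (up e - L (e - θ))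
  have h3 := abs_nonneg (lo e - L (e - θ))
  have h4 := abs_nonneg (up e - L (e - θ))
  exact ⟨by linarith [he.1], by linarith [he.2]⟩

/-- The change of the Lagrangian when the data change. -/
def lagrangianDiff (D D' : Data N ρ) (x : N → ℝ) (y : ρ → ℝ) : ℝ :=
  ∑ j, (D'.2.2 j - D.2.2 j) * x j - ∑ i, (D'.2.1 i - D.2.1 i) * y i +
    ∑ i, ∑ j, (D'.1 i j - D.1 i j) * (x j * y i)

/-- The definition displays the increments of the data, for differentiation; this form displays
costs and complementarity products, for weak duality. -/
lemma lagrangianDiff_eq (D D' : Data N ρ) (x : N → ℝ) (y : ρ → ℝ) : lagrangianDiff D D' x y =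
    D'.2.2 ⬝ᵥ x - D.2.2 ⬝ᵥ x - ((D'.2.1 - D'.1 *ᵥ x) ⬝ᵥ y - (D.2.1 - D.1 *ᵥ x) ⬝ᵥ y) := by
  simp only [lagrangianDiff, sub_dotProduct]
  simp only [dotProduct, mulVec, sub_mul, Finset.sum_sub_distrib, Finset.sum_mul, mul_assoc]
  ring

lemma hasFDerivWithinAt_lagrangianDiff {D : E → Data N ρ} {S : Set E} {θ : E}
    {A' : ρ → N → E →L[ℝ] ℝ} {b' : ρ → E →L[ℝ] ℝ} {c' : N → E →L[ℝ] ℝ}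
    (hA : ∀ i j, HasFDerivWithinAt (fun e => (D e).1 i j) (A' i j) S θ)
    (hb : ∀ i, HasFDerivWithinAt (fun e => (D e).2.1 i) (b' i) S θ)
    (hc : ∀ j, HasFDerivWithinAt (fun e => (D e).2.2 j) (c' j) S θ)
    {X : E → N → ℝ} {Y : E → ρ → ℝ} {x : N → ℝ} {y : ρ → ℝ}
    (hX : Tendsto X (𝓝[S] θ) (𝓝 x)) (hY : Tendsto Y (𝓝[S] θ) (𝓝 y)) :
    HasFDerivWithinAt (fun e => lagrangianDiff (D θ) (D e) (X e) (Y e))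
      (∑ j, x j • c' j - ∑ i, y i • b' i + ∑ i, ∑ j, (x j * y i) • A' i j) S θ := by
  have hXj := fun j => (tendsto_pi_nhds.1 hX) j
  have hYi := fun i => (tendsto_pi_nhds.1 hY) i
  exact ((HasFDerivWithinAt.fun_sum fun j _ => hasFDerivWithinAt_sub_mul (hc j) (hXj j)).sub
    (HasFDerivWithinAt.fun_sum fun i _ => hasFDerivWithinAt_sub_mul (hb i) (hYi i))).add
    (HasFDerivWithinAt.fun_sum fun i _ => HasFDerivWithinAt.fun_sum fun j _ =>
      hasFDerivWithinAt_sub_mul (hA i j) ((hXj j).mul (hYi i)))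

/-- The optimal value of a family of conic programs is differentiable at a parameter with a unique
primal-dual solution. -/
theorem differentiableWithinAt_value {K : PointedCone ℝ (ρ → ℝ)}
    (hK : IsClosed (K : Set (ρ → ℝ))) {D : E → Data N ρ} {S : Set E} {θ : E}
    (hA : ∀ i j, DifferentiableWithinAt ℝ (fun e => (D e).1 i j) S θ)
    (hb : ∀ i, DifferentiableWithinAt ℝ (fun e => (D e).2.1 i) S θ)
    (hc : ∀ j, DifferentiableWithinAt ℝ (fun e => (D e).2.2 j) S θ)
    (hD : Nondegenerate K (D θ)) {x₀ : N → ℝ} {y₀ : ρ → ℝ}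
    (huniq : ∀ x y, IsSaddle K (D θ) x y → x = x₀ ∧ y = y₀)
    {p : E → ℝ} (hp : ∀ e x y, IsSaddle K (D e) x y → p e = (D e).2.2 ⬝ᵥ x) :
    (∀ᶠ e in 𝓝[S] θ, ∃ x y, IsSaddle K (D e) x y) ∧ DifferentiableWithinAt ℝ p S θ := by
  have hcont : Tendsto D (𝓝[S] θ) (𝓝 (D θ)) := by
    refine Tendsto.prodMk_nhds ?_ (Tendsto.prodMk_nhds ?_ ?_)
    · exact tendsto_pi_nhds.2 fun i => tendsto_pi_nhds.2 fun j => (hA i j).continuousWithinAt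
    · exact tendsto_pi_nhds.2 fun i => (hb i).continuousWithinAt
    · exact tendsto_pi_nhds.2 fun j => (hc j).continuousWithinAt
  obtain ⟨X, Y, hXY, hX, hY⟩ := exists_tendsto_isSaddle hK hD huniq hcont
  -- The filter `𝓝[S] θ` need not see `θ` itself, so the saddle point at `θ` is obtained separately.
  obtain ⟨δ, hδ, hbd⟩ := hD.eventually_bound hK
  obtain ⟨x, y, hxy⟩ := exists_isSaddle hK hδ hbd.self_of_nhds
  obtain ⟨rfl, rfl⟩ := huniq x y hxy
  refine ⟨hXY.mono fun e he => ⟨_, _, he⟩, ?_⟩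
  -- Lower bound: moving primal solution, fixed dual one. Upper bound: the reverse. Their
  -- derivatives agree because both use the limits x and y.
  have hlo := hasFDerivWithinAt_lagrangianDiff (fun i j => (hA i j).hasFDerivWithinAt)
    (fun i => (hb i).hasFDerivWithinAt) (fun j => (hc j).hasFDerivWithinAt) hX
    (tendsto_const_nhds (x := y))
  have hup := hasFDerivWithinAt_lagrangianDiff (fun i j => (hA i j).hasFDerivWithinAt)
    (fun i => (hb i).hasFDerivWithinAt) (fun j => (hc j).hasFDerivWithinAt)
    (tendsto_const_nhds (x := x)) hY
  refine (hasFDerivWithinAt_of_squeeze hlo hup (by simp [lagrangianDiff])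
    (by simp [lagrangianDiff]) ?_).differentiableWithinAt
  filter_upwards [hXY] with e he
  rw [hp e _ _ he, hp θ _ _ hxy, lagrangianDiff_eq, lagrangianDiff_eq]
  have h1 := gap_eq (D θ) (X e) hxy.2.2.1
  have h2 := gap_eq (D e) x he.2.2.1
  have h3 := hxy.gap
  have h4 := he.gap
  have h5 := hxy.2.1 _ he.1
  have h6 := he.2.1 _ hxy.1
  constructor <;> linarith

end ConicStability
end

noncomputable section

/-! ## Conic programs over semidefinite cones -/

section Smat

variable {σ : Type} [DecidableEq σ]

lemma smat_apply (v : Sym2 σ → ℝ) (i j : σ) :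
    smat v i j = if i = j then v s(i, j) else v s(i, j) / Real.sqrt 2 := rfl

lemma smat_add (v w : Sym2 σ → ℝ) : smat (v + w) = smat v + smat w := by
  ext i j; simp only [smat_apply, Matrix.add_apply, Pi.add_apply]; split_ifs <;> ring

lemma smat_smul (r : ℝ) (v : Sym2 σ → ℝ) : smat (r • v) = r • smat v := by
  ext i j; simp only [smat_apply, Matrix.smul_apply, Pi.smul_apply, smul_eq_mul]
  split_ifs <;> ring

lemma smat_zero : smat (0 : Sym2 σ → ℝ) = 0 := by
  ext i j; simp [smat_apply]

lemma continuous_smat : Continuous (smat : (Sym2 σ → ℝ) → Matrix σ σ ℝ) := by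
  refine continuous_matrix fun i j => ?_
  simp only [smat_apply]
  split_ifs <;> fun_prop

/-- The vector which encodes a symmetric matrix. -/
def svec (G : Matrix σ σ ℝ) (hG : G.IsSymm) : Sym2 σ → ℝ :=
  Sym2.lift ⟨fun i j => if i = j then G i j else G i j * Real.sqrt 2, fun i j => by
    simp only [eq_comm (a := i) (b := j), hG.apply i j]⟩

lemma smat_svec (G : Matrix σ σ ℝ) (hG : G.IsSymm) : smat (svec G hG) = G := by
  ext i j
  simp only [smat_apply, svec, Sym2.lift_mk]
  split_ifs <;> simp

end Smat

lemma isClosed_setOf_posSemidef {σ : Type} [Fintype σ] :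
    IsClosed {M : Matrix σ σ ℝ | M.PosSemidef} := by
  simp only [Matrix.posSemidef_iff_dotProduct_mulVec, Set.ofPred_and, Set.ofPred_forall]
  refine IsClosed.inter (isClosed_eq continuous_id.matrix_conjTranspose continuous_id) ?_
  refine isClosed_iInter fun x => isClosed_le continuous_const ?_
  exact continuous_const.dotProduct (continuous_id.matrix_mulVec continuous_const)

/-! ### Semidefinite programs as conic programs; uniqueness implies nondegeneracy -/

namespace ConicSDP

open Matrix ConicStability

variable {N E B : Type} {σ : B → Type} [Fintype N] [∀ β, DecidableEq (σ β)]

variable (E σ) in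
/-- The cone of a conic program as a pointed cone. -/
def pointedCone : PointedCone ℝ (E ⊕ (Σ β : B, Sym2 (σ β)) → ℝ) where
  carrier := cone E σ
  add_mem' := fun {a b} ha hb =>
    ⟨fun e => by simp [ha.1 e, hb.1 e], fun β => by
      have : block (a + b) β = block a β + block b β := smat_add _ _
      rw [this]; exact (ha.2 β).add (hb.2 β)⟩
  zero_mem' := ⟨fun e => rfl, fun β => by
    have : block (0 : E ⊕ (Σ β : B, Sym2 (σ β)) → ℝ) β = 0 := smat_zero
    rw [this]; exact Matrix.PosSemidef.zero⟩
  smul_mem' := fun r a ha =>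
    ⟨fun e => by simp [ha.1 e], fun β => by
      have : block (r • a) β = (r : ℝ) • block a β := smat_smul _ _
      rw [this]; exact (ha.2 β).smul r.2⟩

lemma primalFeasible_iff {D : ConicSDP N E B σ} {x : N → ℝ}
    {s : E ⊕ (Σ β : B, Sym2 (σ β)) → ℝ} :
    D.PrimalFeasible x s ↔ s = D.b - D.A *ᵥ x ∧ D.b - D.A *ᵥ x ∈ pointedCone E σ := by
  constructor
  · rintro ⟨h, hs⟩
    have : s = D.b - D.A *ᵥ x := by rw [← h]; abel
    exact ⟨this, this ▸ hs⟩
  · rintro ⟨rfl, h⟩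
    exact ⟨by abel, h⟩

variable [∀ β, Fintype (σ β)]

lemma isClosed_pointedCone :
    IsClosed (pointedCone E σ : Set (E ⊕ (Σ β : B, Sym2 (σ β)) → ℝ)) := by
  have : (pointedCone E σ : Set (E ⊕ (Σ β : B, Sym2 (σ β)) → ℝ)) =
      (⋂ e, {s | s (Sum.inl e) = 0}) ∩ ⋂ β, (fun s => block s β) ⁻¹' {M | M.PosSemidef} := by
    ext s
    simp only [Set.mem_inter_iff, Set.mem_iInter]
    exact Iff.rfl
  rw [this]
  refine (isClosed_iInter fun e => isClosed_eq (continuous_apply _) continuous_const).inter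
    (isClosed_iInter fun β => isClosed_setOf_posSemidef.preimage ?_)
  exact continuous_smat.comp (by fun_prop)

variable [Fintype E] [Fintype B]

/-- The data of a conic program as a tuple. -/
def data (D : ConicSDP N E B σ) : Data N (E ⊕ (Σ β : B, Sym2 (σ β))) := (D.A, D.b, D.c)

lemma isLeast_of_isSaddle {D : ConicSDP N E B σ} {x : N → ℝ}
    {y : E ⊕ (Σ β : B, Sym2 (σ β)) → ℝ} (h : IsSaddle (pointedCone E σ) D.data x y) :
    IsLeast {a | ∃ x s, D.PrimalFeasible x s ∧ D.c ⬝ᵥ x = a} (D.c ⬝ᵥ x) := by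
  refine ⟨⟨x, _, primalFeasible_iff.2 ⟨rfl, h.1⟩, rfl⟩, ?_⟩
  rintro _ ⟨x', s', hx', rfl⟩
  have h1 : 0 ≤ D.c ⬝ᵥ x' + D.b ⬝ᵥ y := gap_nonneg (primalFeasible_iff.1 hx').2 h.2.2.1 h.2.1
  have h2 : D.c ⬝ᵥ x + D.b ⬝ᵥ y = 0 := h.gap
  linarith

lemma isSolution_of_isSaddle {D : ConicSDP N E B σ} {x : N → ℝ}
    {y : E ⊕ (Σ β : B, Sym2 (σ β)) → ℝ} (h : IsSaddle (pointedCone E σ) D.data x y) :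
    D.IsSolution x (D.b - D.A *ᵥ x) y := by
  refine ⟨primalFeasible_iff.2 ⟨rfl, h.1⟩,
    fun x' s' hx' => (isLeast_of_isSaddle h).2 ⟨x', s', hx', rfl⟩, ⟨h.2.2.1, h.2.1⟩,
    fun y' hy' => ?_⟩
  have h1 : 0 ≤ D.c ⬝ᵥ x + D.b ⬝ᵥ y' := gap_nonneg h.1 hy'.1 hy'.2
  have h2 : D.c ⬝ᵥ x + D.b ⬝ᵥ y = 0 := h.gap
  linarith

/-- The parts of a homogeneous solution are recession directions of the two feasible sets. Since
cᵀdx + bᵀdy = -κ ≤ 0, at least one of them does not increase its objective; by uniqueness that one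
is zero, and then so is the rest. Zero duality gap is not presupposed. -/
lemma nondegenerate_of_unique {D : ConicSDP N E B σ} {x : N → ℝ}
    {s y : E ⊕ (Σ β : B, Sym2 (σ β)) → ℝ} (h : D.IsSolution x s y)
    (huniq : ∀ x' s' y', D.IsSolution x' s' y' → x' = x ∧ s' = s ∧ y' = y) :
    Nondegenerate (pointedCone E σ) D.data := by
  rintro ⟨dx, dy, k, κ⟩ hz hz0
  obtain ⟨hdy, hk, hκ⟩ := mem_optCone.1 hz
  simp only at hdy hk hκ
  simp only [optMap_apply, data, Prod.mk_eq_zero] at hz0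
  obtain ⟨h1, h2, h3⟩ := hz0
  obtain ⟨hp, hpo, hd, hdo⟩ := h
  have primal : D.c ⬝ᵥ dx ≤ 0 → dx = 0 ∧ k = 0 := fun hc => by
    have hle : D.c ⬝ᵥ (x + dx) ≤ D.c ⬝ᵥ x := by rw [dotProduct_add]; linarith
    have := huniq (x + dx) (s + k) y ⟨⟨by
      rw [mulVec_add, ← hp.1, add_add_add_comm, h1, add_zero],
      add_mem (S := PointedCone ℝ _) (s := pointedCone E σ) hp.2 hk⟩,
      fun x' s' hx' => hle.trans (hpo x' s' hx'), hd, hdo⟩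
    exact ⟨by simpa using this.1, by simpa using this.2.1⟩
  have dual : D.b ⬝ᵥ dy ≤ 0 → dy = 0 := fun hb => by
    have hle : D.b ⬝ᵥ (y + dy) ≤ D.b ⬝ᵥ y := by rw [dotProduct_add]; linarith
    have := huniq x s (y + dy) ⟨hp, hpo, ⟨by
      rw [mulVec_add, h2, add_zero, hd.1],
      add_mem (S := PointedCone ℝ _) (s := dotDual (pointedCone E σ)) hd.2 hdy⟩,
      fun y' hy' => hle.trans (hdo y' hy')⟩
    simpa using this.2.2
  rcases le_or_gt (D.c ⬝ᵥ dx) 0 with hc | hc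
  · obtain ⟨rfl, rfl⟩ := primal hc
    rw [dotProduct_zero, zero_add] at h3
    obtain rfl := dual (by linarith)
    rw [dotProduct_zero, zero_add] at h3
    rw [h3]; rfl
  · obtain rfl := dual (by linarith)
    rw [dotProduct_zero] at h3
    linarith

end ConicSDP
end

noncomputable section

/-! ## Polynomials of bounded degree and Gram matrices -/

section Polynomials

open MvPolynomial

variable {n m : ℕ} {V : Finset (ZVar n m)} {δ : ℕ}

lemma isPolyIn_iff {p : ZPoly n m} :
    IsPolyIn V δ p ↔ ∀ e ∈ p.support, e.support ⊆ V ∧ e.degree ≤ δ := by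
  have h2 : p.totalDegree ≤ δ ↔ ∀ e ∈ p.support, e.degree ≤ δ := Finset.sup_le_iff
  rw [IsPolyIn, h2]
  constructor
  · exact fun h e he => ⟨fun i hi => h.1 ((mem_vars_iff_mem_support i).2 ⟨e, he, hi⟩), h.2 e he⟩
  · intro h
    refine ⟨fun i hi => ?_, fun e he => (h e he).2⟩
    obtain ⟨e, he, hie⟩ := (mem_vars_iff_mem_support i).1 hi
    exact (h e he).1 hie

lemma coeff_sum_monomial (c : Mono V δ → ℝ) (d : Mono V δ) :
    (∑ e : Mono V δ, monomial e.1 (c e)).coeff d.1 = c d := by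
  classical
  rw [coeff_sum, Finset.sum_eq_single d]
  · simp
  · intro e _ he
    rw [coeff_monomial, if_neg fun h => he (Subtype.ext h)]
  · simp

lemma coeff_sum_monomial_of_not {c : Mono V δ → ℝ} {d : ZVar n m →₀ ℕ}
    (hd : ¬ (d.support ⊆ V ∧ d.degree ≤ δ)) :
    (∑ e : Mono V δ, monomial e.1 (c e)).coeff d = 0 := by
  classical
  rw [coeff_sum]
  refine Finset.sum_eq_zero fun e _ => ?_
  rw [coeff_monomial, if_neg]
  rintro rfl
  exact hd e.2

lemma isPolyIn_sum_monomial (c : Mono V δ → ℝ) :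
    IsPolyIn V δ (∑ e : Mono V δ, monomial e.1 (c e)) := by
  rw [isPolyIn_iff]
  intro d hd
  by_contra h
  exact mem_support_iff.1 hd (coeff_sum_monomial_of_not h)

lemma IsPolyIn.eq_sum_monomial {p : ZPoly n m} (hp : IsPolyIn V δ p) :
    ∑ e : Mono V δ, monomial e.1 (p.coeff e.1) = p := by
  ext d
  by_cases hd : d.support ⊆ V ∧ d.degree ≤ δ
  · exact coeff_sum_monomial _ (⟨d, hd⟩ : Mono V δ)
  · rw [coeff_sum_monomial_of_not hd, eq_comm, ← notMem_support_iff]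
    exact fun h => hd (isPolyIn_iff.1 hp d h)

lemma IsPolyIn.sum_support {p : ZPoly n m} (hp : IsPolyIn V δ p) (g : (ZVar n m →₀ ℕ) → ℝ) :
    ∑ e ∈ p.support, p.coeff e * g e = ∑ e : Mono V δ, p.coeff e.1 * g e.1 := by
  classical
  refine (Finset.sum_subset (s₂ := Finset.univ.image fun e : Mono V δ => e.1) ?_ ?_).trans
    (Finset.sum_image fun _ _ _ _ h => Subtype.ext h)
  · intro d hd
    exact Finset.mem_image.2 ⟨⟨d, isPolyIn_iff.1 hp d hd⟩, Finset.mem_univ _, rfl⟩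
  · intro d _ hd
    rw [notMem_support_iff.1 hd, zero_mul]

lemma gramPoly_add_smul (G H : Matrix (Mono V δ) (Mono V δ) ℝ) (r : ℝ) :
    gramPoly (G + r • H) = gramPoly G + r • gramPoly H := by
  simp only [gramPoly, Matrix.add_apply, Matrix.smul_apply, map_add, Finset.sum_add_distrib,
    Finset.smul_sum, smul_monomial]

/-- A rank-one Gram matrix aaᵀ is the square of the polynomial with coefficient vector a. -/
lemma gramPoly_sum_vecMulVec {ι : Type*} (s : Finset ι) (a : ι → Mono V δ → ℝ) :
    gramPoly (∑ j ∈ s, Matrix.vecMulVec (a j) (a j)) =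
      ∑ j ∈ s, (∑ e : Mono V δ, monomial e.1 (a j e)) ^ 2 := by
  simp only [gramPoly, Matrix.sum_apply, map_sum, Matrix.vecMulVec_apply, sq, Finset.sum_mul_sum,
    monomial_mul]
  exact (Finset.sum_congr rfl fun _ _ => Finset.sum_comm).trans Finset.sum_comm

lemma totalDegree_gramPoly_le (G : Matrix (Mono V δ) (Mono V δ) ℝ) :
    (gramPoly G).totalDegree ≤ 2 * δ := by
  refine totalDegree_finsetSum_le fun a _ => totalDegree_finsetSum_le fun b _ => ?_
  refine (totalDegree_monomial_le _ _).trans ?_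
  have h := map_add Finsupp.degree a.1 b.1
  have ha := a.2.2
  have hb := b.2.2
  change (a.1 + b.1).degree ≤ _
  omega

/-- The vectors are the rows of the symmetric square root of G. -/
lemma Matrix.PosSemidef.exists_eq_sum_vecMulVec {ι : Type*} [Fintype ι] [DecidableEq ι]
    {G : Matrix ι ι ℝ} (hG : G.PosSemidef) :
    ∃ a : ι → ι → ℝ, G = ∑ j, Matrix.vecMulVec (a j) (a j) := by
  open scoped MatrixOrder in
  have h1 := CFC.sqrt_mul_sqrt_self G hG.nonneg
  have h2 : (CFC.sqrt G).IsHermitian := (Matrix.nonneg_iff_posSemidef.1 (CFC.sqrt_nonneg G)).1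
  refine ⟨fun j => CFC.sqrt G j, ?_⟩
  ext i k
  conv_lhs => rw [← h1]
  rw [Matrix.mul_apply, Matrix.sum_apply]
  refine Finset.sum_congr rfl fun j _ => ?_
  rw [Matrix.vecMulVec_apply, ← h2.apply i j, star_trivial]

lemma isSOSIn_gramPoly {G : Matrix (Mono V δ) (Mono V δ) ℝ} (hG : G.PosSemidef) :
    IsSOSIn V δ (gramPoly G) := by
  obtain ⟨a, rfl⟩ := hG.exists_eq_sum_vecMulVec
  refine ⟨Fintype.card (Mono V δ), fun j => ∑ e : Mono V δ,
    monomial e.1 (a ((Fintype.equivFin _).symm j) e), fun j => isPolyIn_sum_monomial _, ?_⟩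
  rw [gramPoly_sum_vecMulVec]
  exact ((Fintype.equivFin _).symm.sum_comp fun j =>
    (∑ e : Mono V δ, monomial e.1 (a j e)) ^ 2).symm

lemma IsSOSIn.exists_gramPoly_eq {q : ZPoly n m} (hq : IsSOSIn V δ q) :
    ∃ G : Matrix (Mono V δ) (Mono V δ) ℝ, G.PosSemidef ∧ gramPoly G = q := by
  obtain ⟨N, p, hp, rfl⟩ := hq
  refine ⟨∑ j, Matrix.vecMulVec (fun e => (p j).coeff e.1) (fun e => (p j).coeff e.1),
    Matrix.posSemidef_sum _ fun j _ => ?_, ?_⟩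
  · simpa using Matrix.posSemidef_vecMulVec_self_star fun e : Mono V δ => (p j).coeff e.1
  · rw [gramPoly_sum_vecMulVec]
    exact Finset.sum_congr rfl fun j _ => by rw [(hp j).eq_sum_monomial]

lemma substVar_eq (z : ZVar n m) (a : ℝ) (p : ZPoly n m) : substVar z a p =
    ∑ d ∈ p.support, C (p.coeff d) *
      ∏ i ∈ d.support, (if i = z then C a else X i) ^ d i := by
  rw [substVar, aeval_def, eval₂_eq]; rfl

lemma totalDegree_substVar_le (z : ZVar n m) (a : ℝ) (p : ZPoly n m) :
    (substVar z a p).totalDegree ≤ p.totalDegree := by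
  rw [substVar_eq]
  refine totalDegree_finsetSum_le fun d hd => (totalDegree_mul _ _).trans ?_
  rw [totalDegree_C, zero_add]
  refine (totalDegree_finsetProd _ _).trans (le_trans ?_ (le_totalDegree hd))
  refine Finset.sum_le_sum fun i _ => (totalDegree_pow _ _).trans ?_
  split_ifs <;> simp

end Polynomials

/-! ### Equivalence of the polynomial relaxation and its semidefinite program -/

namespace SplitROA

open MvPolynomial

variable {P : SplitROA}

lemma lie_add_smul (v v' : ZPoly P.n P.m) (r : ℝ) :
    P.lie (v + r • v') = P.lie v + r • P.lie v' := by
  simp only [lie, map_add, Derivation.map_smul, add_mul, smul_mul_assoc, Finset.sum_add_distrib,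
    smul_add, Finset.smul_sum]
  abel

/-- The left-hand sides are only affine, because of the constant -1 in `init`; subtracting the value
at 0 leaves the linear part. -/
lemma Con.lhs_add_smul (θ : P.Split → ℝ) (κ : P.Con)
    (v v' : P.Cell → Fin (P.nt + 1) → ZPoly P.n P.m) (w w' : P.Cell → ZPoly P.n P.m) (r : ℝ) :
    κ.lhs θ (v + r • v') (w + r • w') =
      κ.lhs θ v w + r • (κ.lhs θ v' w' - κ.lhs θ 0 0) := by
  have hlie : P.lie 0 = 0 := by simp [lie]
  cases κ <;>
    simp only [Con.lhs, Pi.add_apply, Pi.smul_apply, Pi.zero_apply, lie_add_smul, hlie, substVar,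
      map_add, map_sub, map_smul, map_zero, smul_sub, smul_neg, sub_zero, neg_zero,
      neg_add, zero_sub] <;> abel

namespace Relaxation

variable (R : P.Relaxation)

variable {R} in
lemma polyV_add_smul (x x' : R.DecVar → ℝ) (r : ℝ) :
    polyV (x + r • x') = polyV x + r • polyV x' := by
  ext1 i; ext1 k
  simp only [polyV, Pi.add_apply, Pi.smul_apply, map_add, Finset.sum_add_distrib, Finset.smul_sum,
    smul_monomial]

variable {R} in
lemma polyW_add_smul (x x' : R.DecVar → ℝ) (r : ℝ) :
    polyW (x + r • x') = polyW x + r • polyW x' := by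
  ext1 i
  simp only [polyW, Pi.add_apply, Pi.smul_apply, map_add, Finset.sum_add_distrib, Finset.smul_sum,
    smul_monomial]

variable {R} in
lemma polyQ_add_smul (x x' : R.DecVar → ℝ) (r : ℝ) (B : R.Block) :
    polyQ (x + r • x') B = polyQ x B + r • polyQ x' B := by
  rw [polyQ, polyQ, polyQ, ← gramPoly_add_smul, ← smat_smul, ← smat_add]
  rfl

variable {R} in
lemma polyV_zero : polyV (0 : R.DecVar → ℝ) = 0 := by
  ext1 i; ext1 k; simp [polyV]

variable {R} in
lemma polyW_zero : polyW (0 : R.DecVar → ℝ) = 0 := by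
  ext1 i; simp [polyW]

variable {R} in
lemma polyQ_zero (B : R.Block) : polyQ (0 : R.DecVar → ℝ) B = 0 := by
  have : (smat fun e : Sym2 (R.BlockIdx B) => (0 : R.DecVar → ℝ) (Sum.inr (Sum.inr ⟨B, e⟩))) = 0 :=
    smat_zero
  rw [polyQ, this]; simp [gramPoly]

lemma residual_add_smul (θ : P.Split → ℝ) (κ : P.Con) (x x' : R.DecVar → ℝ) (r : ℝ) :
    R.residual θ κ (x + r • x') =
      R.residual θ κ x + r • (R.residual θ κ x' - R.residual θ κ 0) := by
  simp only [residual, polyV_add_smul, polyW_add_smul, polyQ_add_smul, Con.lhs_add_smul, polyV_zero,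
    polyW_zero, polyQ_zero, add_mul, zero_mul, smul_mul_assoc, Finset.sum_add_distrib,
    ← Finset.smul_sum, Finset.sum_const_zero, smul_sub, smul_zero]
  abel

/-- The linear part of the residual of a constraint. -/
def residualLin (θ : P.Split → ℝ) (κ : P.Con) : (R.DecVar → ℝ) →ₗ[ℝ] ZPoly P.n P.m where
  toFun x := R.residual θ κ x - R.residual θ κ 0
  map_add' x x' := by
    have := R.residual_add_smul θ κ x x' 1
    rw [one_smul, one_smul] at this
    rw [this]; abel
  map_smul' r x := by
    have := R.residual_add_smul θ κ 0 x r
    rw [zero_add] at this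
    rw [this, add_sub_cancel_left, RingHom.id_apply]

lemma sdp_mulVec_inl (θ : P.Split → ℝ) (x : R.DecVar → ℝ) (E : R.EqRow) :
    (R.sdp θ).A.mulVec x (Sum.inl E) =
      (R.residual θ E.1.1 x).coeff E.1.2 - (R.residual θ E.1.1 0).coeff E.1.2 := by
  classical
  rw [← coeff_sub]
  change _ = (R.residualLin θ E.1.1 x).coeff E.1.2
  rw [LinearMap.pi_apply_eq_sum_univ (R.residualLin θ E.1.1) x, coeff_sum]
  refine Finset.sum_congr rfl fun j _ => ?_
  rw [coeff_smul, smul_eq_mul, mul_comm]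
  congr 1
  rw [residualLin]
  simp only [sdp, Matrix.of_apply, LinearMap.coe_mk, AddHom.coe_mk, coeff_sub]
  congr 3
  ext i
  rw [Pi.single_apply]
  split_ifs with h1 h2 h2 <;> first | rfl | exact absurd h1.symm h2 | exact absurd h2.symm h1

lemma sdp_mulVec_inr (θ : P.Split → ℝ) (x : R.DecVar → ℝ)
    (e : Σ B : R.Block, Sym2 (R.BlockIdx B)) :
    (R.sdp θ).A.mulVec x (Sum.inr e) = - x (Sum.inr (Sum.inr e)) := by
  simp only [Matrix.mulVec, dotProduct, sdp, Matrix.of_apply]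
  rw [Finset.sum_eq_single (Sum.inr (Sum.inr e))]
  · simp
  · intro j _ hj
    rw [if_neg hj, zero_mul]
  · simp

lemma totalDegree_residual_le (hdeg : R.DegreesWithinOrder) (θ : P.Split → ℝ) (κ : P.Con)
    (x : R.DecVar → ℝ) : (R.residual θ κ x).totalDegree ≤ R.d := by
  obtain ⟨hV, hW, hlie, hgen⟩ := hdeg
  have hv : ∀ i k, (polyV x i k).totalDegree ≤ R.d := fun i k =>
    (isPolyIn_sum_monomial _).2.trans (hV i k)
  have hw : ∀ i, (polyW x i).totalDegree ≤ R.d := fun i =>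
    (isPolyIn_sum_monomial _).2.trans (hW i)
  refine (totalDegree_sub _ _).trans (max_le ?_ ?_)
  · cases κ with
    | dyn i k => exact (totalDegree_neg _).le.trans (hlie i k _ (isPolyIn_sum_monomial _))
    | init i =>
      refine (totalDegree_sub _ _).trans (max_le ((totalDegree_sub _ _).trans (max_le (hw i)
        ((totalDegree_substVar_le _ _ _).trans (hv _ _)))) ?_)
      rw [totalDegree_one]; exact Nat.zero_le _
    | term i => exact (totalDegree_substVar_le _ _ _).trans (hv _ _)
    | nonneg i => exact hw i
    | jump i k =>
      exact (totalDegree_substVar_le _ _ _).trans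
        ((totalDegree_sub _ _).trans (max_le (hv _ _) (hv _ _)))
    | facetPos F k =>
      exact (totalDegree_substVar_le _ _ _).trans
        ((totalDegree_sub _ _).trans (max_le (hv _ _) (hv _ _)))
    | facetNeg F k =>
      exact (totalDegree_substVar_le _ _ _).trans
        ((totalDegree_sub _ _).trans (max_le (hv _ _) (hv _ _)))
  · refine totalDegree_finsetSum_le fun B _ => (totalDegree_mul _ _).trans ?_
    exact (Nat.add_le_add_right (totalDegree_gramPoly_le _) _).trans (hgen θ B)

/-- Omitting void rows loses nothing: a nonzero coefficient is itself the witness that its row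
belongs to the program, and the degree bound covers its monomial. -/
lemma forall_eqRow_iff (hdeg : R.DegreesWithinOrder) (θ : P.Split → ℝ) (x : R.DecVar → ℝ) :
    (∀ E : R.EqRow, (R.residual θ E.1.1 x).coeff E.1.2 = 0) ↔ ∀ κ, R.residual θ κ x = 0 := by
  constructor
  · intro h κ
    ext e
    rw [coeff_zero]
    by_contra hne
    refine hne (h ⟨(κ, e), ?_, θ, x, hne⟩)
    exact (le_totalDegree (mem_support_iff.2 hne)).trans (R.totalDegree_residual_le hdeg θ κ x)
  · intro h E
    rw [h, coeff_zero]

lemma exists_primalFeasible_iff (hdeg : R.DegreesWithinOrder) (θ : P.Split → ℝ)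
    (x : R.DecVar → ℝ) : (∃ s, (R.sdp θ).PrimalFeasible x s) ↔
      (∀ κ, R.residual θ κ x = 0) ∧
      ∀ B, (smat fun e : Sym2 (R.BlockIdx B) => x (Sum.inr (Sum.inr ⟨B, e⟩))).PosSemidef := by
  simp only [ConicSDP.primalFeasible_iff, exists_eq_left, ← R.forall_eqRow_iff hdeg]
  refine and_congr (forall_congr' fun E => ?_) (forall_congr' fun B => ?_)
  · rw [Pi.sub_apply, sdp_mulVec_inl]
    simp only [sdp]
    constructor <;> intro h <;> linarith
  · have : (fun e => ((R.sdp θ).b - (R.sdp θ).A.mulVec x) (Sum.inr ⟨B, e⟩)) =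
        fun e : Sym2 (R.BlockIdx B) => x (Sum.inr (Sum.inr ⟨B, e⟩)) := by
      ext e
      rw [Pi.sub_apply, sdp_mulVec_inr]
      simp [sdp]
    rw [ConicSDP.block, this]

lemma sdp_c_dotProduct (θ : P.Split → ℝ) (x : R.DecVar → ℝ) :
    (R.sdp θ).c ⬝ᵥ x = cost P θ (polyW x) := by
  simp only [dotProduct, sdp, Fintype.sum_sum_type, zero_mul, Finset.sum_const_zero, zero_add,
    add_zero, cost]
  rw [Fintype.sum_sigma]
  refine Finset.sum_congr rfl fun i _ => ?_
  have h := (isPolyIn_sum_monomial fun e : Mono (xVars P.n P.m) (R.degW i) =>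
    x (Sum.inr (Sum.inl ⟨i, e⟩))).sum_support (P.moment θ i)
  rw [polyW, h]
  exact Finset.sum_congr rfl fun e _ => by rw [coeff_sum_monomial, mul_comm]

/-- The relaxation and its semidefinite program have the same objective values. -/
theorem costs_eq (hdeg : R.DegreesWithinOrder) (θ : P.Split → ℝ) :
    R.costs θ = {a | ∃ x s, (R.sdp θ).PrimalFeasible x s ∧ (R.sdp θ).c ⬝ᵥ x = a} := by
  ext a
  constructor
  · rintro ⟨v, w, ⟨hv, hw, q, hq, hκ⟩, rfl⟩
    choose G hG hGq using fun B => (hq B).exists_gramPoly_eq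
    have hsymm : ∀ B, (G B).IsSymm := fun B => (hG B).1
    set x : R.DecVar → ℝ := Sum.elim (fun e => (v e.1.1 e.1.2).coeff e.2.1)
      (Sum.elim (fun e => (w e.1).coeff e.2.1) fun e => svec (G e.1) (hsymm e.1) e.2) with hx
    have hxv : polyV x = v := by
      ext1 i; ext1 k
      exact (hv i k).eq_sum_monomial
    have hxw : polyW x = w := by
      ext1 i
      exact (hw i).eq_sum_monomial
    have hsm : ∀ B, (smat fun e : Sym2 (R.BlockIdx B) => x (Sum.inr (Sum.inr ⟨B, e⟩))) = G B :=
      fun B => smat_svec (G B) (hsymm B)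
    have hxq : ∀ B, polyQ x B = q B := fun B => by
      rw [polyQ, hsm, hGq]
    obtain ⟨s, hs⟩ := (R.exists_primalFeasible_iff hdeg θ x).2
      ⟨fun κ => by rw [residual, hxv, hxw, hκ κ, sub_eq_zero]; simp only [hxq],
        fun B => by rw [hsm]; exact hG B⟩
    exact ⟨x, s, hs, by rw [sdp_c_dotProduct, hxw]⟩
  · rintro ⟨x, s, hxs, rfl⟩
    obtain ⟨h1, h2⟩ := (R.exists_primalFeasible_iff hdeg θ x).1 ⟨s, hxs⟩
    exact ⟨polyV x, polyW x, ⟨fun i k => isPolyIn_sum_monomial _, fun i => isPolyIn_sum_monomial _,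
      polyQ x, fun B => isSOSIn_gramPoly (h2 B), fun κ => sub_eq_zero.1 (h1 κ)⟩,
      (R.sdp_c_dotProduct θ x).symm⟩

end Relaxation

end SplitROA

end

noncomputable section

/-! ## Dependence of the data on the split positions -/

section CoeffDifferentiable

open MvPolynomial

variable {E : Type*} [NormedAddCommGroup E] [NormedSpace ℝ E] {τ : Type*}

/-- All coefficients of a family of polynomials are differentiable functions of the parameter. -/
def CoeffDifferentiable (F : E → MvPolynomial τ ℝ) : Prop :=
  ∀ d, Differentiable ℝ fun e => (F e).coeff d

namespace CoeffDifferentiable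

variable {F G : E → MvPolynomial τ ℝ}

lemma const (p : MvPolynomial τ ℝ) : CoeffDifferentiable fun _ : E => p :=
  fun _ => differentiable_const _

lemma add (hF : CoeffDifferentiable F) (hG : CoeffDifferentiable G) :
    CoeffDifferentiable fun e => F e + G e := fun d => by
  simpa only [coeff_add] using (hF d).fun_add (hG d)

lemma sub (hF : CoeffDifferentiable F) (hG : CoeffDifferentiable G) :
    CoeffDifferentiable fun e => F e - G e := fun d => by
  simpa only [coeff_sub] using (hF d).fun_sub (hG d)

lemma neg (hF : CoeffDifferentiable F) : CoeffDifferentiable fun e => - F e := fun d => by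
  simpa only [coeff_neg] using (hF d).fun_neg

lemma mul (hF : CoeffDifferentiable F) (hG : CoeffDifferentiable G) :
    CoeffDifferentiable fun e => F e * G e := fun d => by
  classical
  simp only [coeff_mul]
  exact Differentiable.fun_sum fun a _ => (hF a.1).fun_mul (hG a.2)

lemma sum {ι : Type*} {s : Finset ι} {F : ι → E → MvPolynomial τ ℝ}
    (hF : ∀ i ∈ s, CoeffDifferentiable (F i)) :
    CoeffDifferentiable fun e => ∑ i ∈ s, F i e := fun d => by
  simp only [coeff_sum]
  exact Differentiable.fun_sum fun i hi => hF i hi d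

lemma pow (hF : CoeffDifferentiable F) (k : ℕ) : CoeffDifferentiable fun e => F e ^ k := by
  induction k with
  | zero => simpa only [pow_zero] using const 1
  | succ k ih => simpa only [pow_succ] using ih.mul hF

lemma prod {ι : Type*} {s : Finset ι} {F : ι → E → MvPolynomial τ ℝ}
    (hF : ∀ i ∈ s, CoeffDifferentiable (F i)) :
    CoeffDifferentiable fun e => ∏ i ∈ s, F i e := by
  classical
  induction s using Finset.induction_on with
  | empty => simpa only [Finset.prod_empty] using const 1
  | insert a s ha ih =>
    simp only [Finset.prod_insert ha]
    exact (hF a (Finset.mem_insert_self a s)).mul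
      (ih fun i hi => hF i (Finset.mem_insert_of_mem hi))

lemma C {g : E → ℝ} (hg : Differentiable ℝ g) :
    CoeffDifferentiable fun e => (MvPolynomial.C (g e) : MvPolynomial τ ℝ) := fun d => by
  classical
  simp only [coeff_C]
  split_ifs
  · exact hg
  · exact differentiable_const _

end CoeffDifferentiable

variable {n m : ℕ}

lemma coeffDifferentiable_substVar (z : ZVar n m) {g : E → ℝ} (hg : Differentiable ℝ g)
    (p : ZPoly n m) : CoeffDifferentiable fun e => substVar z (g e) p := by
  simp only [substVar_eq]
  refine .sum fun d _ => .mul (.const _) (.prod fun i _ => .pow ?_ _)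
  split_ifs
  · exact .C hg
  · exact .const _

lemma coeffDifferentiable_intervalPoly (z : ZVar n m) {g h : E → ℝ} (hg : Differentiable ℝ g)
    (hh : Differentiable ℝ h) : CoeffDifferentiable fun e => intervalPoly z (g e) (h e) :=
  .mul (.sub (.const _) (.C hg)) (.sub (.C hh) (.const _))

end CoeffDifferentiable

/-! ### Smoothness of the constraints and moments in the split positions -/

namespace SplitROA

variable {P : SplitROA}

lemma differentiable_timeNode (k : Fin (P.nt + 2)) :
    Differentiable ℝ fun θ : P.Split → ℝ => P.timeNode θ k := by
  refine Fin.cases ?_ (fun k => ?_) k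
  · simp only [timeNode, Fin.cons_zero]
    exact differentiable_const _
  · simp only [timeNode, Fin.cons_succ]
    refine Fin.lastCases ?_ (fun k => ?_) k
    · simp only [Fin.snoc_last]
      exact differentiable_const _
    · simp only [Fin.snoc_castSucc]
      fun_prop

lemma differentiable_axisNode (p : Fin P.n) (j : Fin (P.r p + 2)) :
    Differentiable ℝ fun θ : P.Split → ℝ => P.axisNode θ p j := by
  refine Fin.cases ?_ (fun k => ?_) j
  · simp only [axisNode, Fin.cons_zero]
    exact differentiable_const _
  · simp only [axisNode, Fin.cons_succ]
    refine Fin.lastCases ?_ (fun k => ?_) k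
    · simp only [Fin.snoc_last]
      exact differentiable_const _
    · simp only [Fin.snoc_castSucc]
      fun_prop

lemma coeffDifferentiable_lhs (κ : P.Con) (v : P.Cell → Fin (P.nt + 1) → ZPoly P.n P.m)
    (w : P.Cell → ZPoly P.n P.m) :
    CoeffDifferentiable fun θ : P.Split → ℝ => κ.lhs θ v w := by
  cases κ with
  | dyn i k => exact .const _
  | init i => exact .const _
  | term i => exact .const _
  | nonneg i => exact .const _
  | jump i k => exact coeffDifferentiable_substVar _ (differentiable_apply _) _
  | facetPos F k => exact coeffDifferentiable_substVar _ (differentiable_apply _) _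
  | facetNeg F k => exact coeffDifferentiable_substVar _ (differentiable_apply _) _

lemma coeffDifferentiable_timePoly (κ : P.Con) :
    CoeffDifferentiable fun θ : P.Split → ℝ => κ.timePoly θ := by
  cases κ <;> first
    | exact .const _
    | exact coeffDifferentiable_intervalPoly _ (differentiable_timeNode _)
        (differentiable_timeNode _)

lemma coeffDifferentiable_flowPoly (κ : P.Con) :
    CoeffDifferentiable fun θ : P.Split → ℝ => κ.flowPoly θ := by
  cases κ <;> first
    | exact .const _
    | exact coeffDifferentiable_substVar _ (differentiable_apply _) _
    | exact (coeffDifferentiable_substVar _ (differentiable_apply _) _).neg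

lemma coeffDifferentiable_gen (ρ : ℝ) (κ : P.Con) (g : P.Gen) :
    CoeffDifferentiable fun θ : P.Split → ℝ => κ.gen θ ρ g := by
  cases g with
  | one => exact .const _
  | time => exact coeffDifferentiable_timePoly κ
  | axis p =>
    exact coeffDifferentiable_intervalPoly _ (differentiable_axisNode _ _)
      (differentiable_axisNode _ _)
  | input j => exact .const _
  | target j => exact .const _
  | flow => exact coeffDifferentiable_flowPoly κ
  | ball => exact .const _

lemma Relaxation.coeffDifferentiable_residual (R : P.Relaxation) (κ : P.Con) (x : R.DecVar → ℝ) :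
    CoeffDifferentiable fun θ : P.Split → ℝ => R.residual θ κ x :=
  .sub (coeffDifferentiable_lhs _ _ _)
    (.sum fun _ _ => .mul (.const _) (coeffDifferentiable_gen _ _ _))

/-- The moments of a box. -/
lemma moment_eq {θ : P.Split → ℝ} (hθ : θ ∈ P.ordered) (i : P.Cell)
    (e : ZVar P.n P.m →₀ ℕ) : P.moment θ i e =
      ∏ p, (P.axisNode θ p (i p).succ ^ (e (xv p) + 1) -
        P.axisNode θ p (i p).castSucc ^ (e (xv p) + 1)) / ((e (xv p) : ℝ) + 1) := by
  have hset : P.cellSet θ i = Set.univ.pi fun p =>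
      Set.Icc (P.axisNode θ p (i p).castSucc) (P.axisNode θ p (i p).succ) := by
    ext x; simp only [Set.mem_univ_pi, Set.mem_Icc]; rfl
  rw [moment, hset, volume_pi, Measure.restrict_pi_pi,
    integral_fintype_prod_eq_prod fun p (y : ℝ) => y ^ e (xv p)]
  refine Finset.prod_congr rfl fun p _ => ?_
  -- Order of the nodes is essential: for reversed endpoints the interval is empty, whereas the
  -- formula need not vanish.
  rw [integral_Icc_eq_integral_Ioc, ← intervalIntegral.integral_of_le
    (hθ.2 p (Fin.castSucc_lt_succ).le), integral_pow]

lemma differentiableWithinAt_moment {θ : P.Split → ℝ} (hθ : θ ∈ P.ordered) (i : P.Cell)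
    (e : ZVar P.n P.m →₀ ℕ) :
    DifferentiableWithinAt ℝ (fun θ => P.moment θ i e) P.ordered θ := by
  refine DifferentiableWithinAt.congr ?_ (fun θ' hθ' => moment_eq hθ' i e) (moment_eq hθ i e)
  refine Differentiable.differentiableAt ?_ |>.differentiableWithinAt
  have h := fun p j => differentiable_axisNode (P := P) p j
  fun_prop

lemma isOpen_strictlyOrdered : IsOpen P.strictlyOrdered := by
  have : P.strictlyOrdered =
      (⋂ k : Fin (P.nt + 1), {θ | P.timeNode θ k.castSucc < P.timeNode θ k.succ}) ∩
        ⋂ p, ⋂ j : Fin (P.r p + 1), {θ | P.axisNode θ p j.castSucc < P.axisNode θ p j.succ} := by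
    ext θ
    simp only [Set.mem_inter_iff, Set.mem_iInter]
    exact and_congr Fin.strictMono_iff_lt_succ (forall_congr' fun p => Fin.strictMono_iff_lt_succ)
  rw [this]
  exact (isOpen_iInter_of_finite fun k => isOpen_lt (differentiable_timeNode _).continuous
    (differentiable_timeNode _).continuous).inter
    (isOpen_iInter_of_finite fun p => isOpen_iInter_of_finite fun j =>
      isOpen_lt (differentiable_axisNode _ _).continuous (differentiable_axisNode _ _).continuous)

lemma strictlyOrdered_subset_ordered : P.strictlyOrdered ⊆ P.ordered :=
  fun _ h => ⟨h.1.monotone, fun p => (h.2 p).monotone⟩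

open ConicSDP in
/-- Differentiability of the optimal value of the relaxation, and solvability of the relaxation for
nearby split positions, at split positions with a unique primal-dual solution. -/
theorem Relaxation.differentiableWithinAt_value (R : P.Relaxation) (hdeg : R.DegreesWithinOrder)
    {θ : P.Split → ℝ} (hθ : θ ∈ P.ordered) (hsol : (R.sdp θ).HasUniqueStrictSolution) :
    (∀ᶠ θ' in 𝓝[P.ordered] θ, IsGLB (R.costs θ') (R.value θ')) ∧
    DifferentiableWithinAt ℝ R.value P.ordered θ := by
  obtain ⟨x, s, y, hxsy, huniq, -⟩ := hsol
  have hleast : ∀ θ' x y, ConicStability.IsSaddle (pointedCone R.EqRow R.BlockIdx)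
      (R.sdp θ').data x y → IsLeast (R.costs θ') ((R.sdp θ').c ⬝ᵥ x) := fun θ' x y h =>
    R.costs_eq hdeg θ' ▸ isLeast_of_isSaddle h
  have hA : ∀ i j, DifferentiableWithinAt ℝ (fun θ' => (R.sdp θ').A i j) P.ordered θ := by
    intro i j
    refine Differentiable.differentiableAt ?_ |>.differentiableWithinAt
    rcases i with E | e
    · exact ((R.coeffDifferentiable_residual _ _).sub (R.coeffDifferentiable_residual _ _)) _
    · exact differentiable_const _
  have hb : ∀ i, DifferentiableWithinAt ℝ (fun θ' => (R.sdp θ').b i) P.ordered θ := by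
    intro i
    refine Differentiable.differentiableAt ?_ |>.differentiableWithinAt
    rcases i with E | e
    · exact (R.coeffDifferentiable_residual _ _).neg _
    · exact differentiable_const _
  have hc : ∀ j, DifferentiableWithinAt ℝ (fun θ' => (R.sdp θ').c j) P.ordered θ := by
    rintro (j | ⟨i, e⟩ | j)
    · exact differentiableWithinAt_const _
    · exact differentiableWithinAt_moment hθ i e.1
    · exact differentiableWithinAt_const _
  obtain ⟨hex, hdiff⟩ := ConicStability.differentiableWithinAt_value
    (K := pointedCone R.EqRow R.BlockIdx) isClosed_pointedCone (D := fun θ' => (R.sdp θ').data)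
    (p := R.value) hA hb hc (nondegenerate_of_unique hxsy huniq)
    -- Every saddle point is a primal-dual solution, so uniqueness passes to saddle points.
    (fun x' y' h => have := huniq x' _ y' (isSolution_of_isSaddle h); ⟨this.1, this.2.2⟩)
    fun θ' x' y' h => (hleast θ' x' y' h).csInf_eq
  refine ⟨hex.mono ?_, hdiff⟩
  rintro θ' ⟨x', y', h⟩
  rw [Relaxation.value, (hleast θ' x' y' h).csInf_eq]
  exact (hleast θ' x' y' h).isGLB

end SplitROA

end

/-! ### The main theorem -/

theorem mainTheorem2 (P : SplitROA) (R : P.Relaxation) (hdeg : R.DegreesWithinOrder)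
    (θ : P.Split → ℝ) (hθ : θ ∈ P.ordered)
    (hball : R.BallConstraints θ) (hflow : P.FlowNonzero θ)
    (hsol : (R.sdp θ).HasUniqueStrictSolution) :
    (∀ᶠ θ' in 𝓝[P.ordered] θ, IsGLB (R.costs θ') (R.value θ')) ∧
    DifferentiableWithinAt ℝ R.value P.ordered θ ∧
    (θ ∈ P.strictlyOrdered → DifferentiableAt ℝ R.value θ) := by
  obtain ⟨h1, h2⟩ := R.differentiableWithinAt_value hdeg hθ hsol
  refine ⟨h1, h2, fun hs => h2.differentiableAt ?_⟩
  -- Strictly ordered positions form an open subset of the ordered ones, so there the relative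
  -- derivative is a full derivative.
  exact mem_of_superset (SplitROA.isOpen_strictlyOrdered.mem_nhds hs)
    SplitROA.strictlyOrdered_subset_ordered
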